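/- Let $X$ be a topological space, $X=U\cup V$, where $U,V\subset X$ are open and path-connected, and suppose that $U\cap V$ has exactly $m+1$ path components $A_0,A_1,\dots,A_m$. Assume that $A_0$ is open in $X$ (for example, that $X$ is locally path-connected) or that $X$ is Hausdorff. Choose $a_i\in A_i$ for $i=0,\dots,m$, put $b=a_0$, and for $k=1,\dots,m$ let $p_k$ be a path in $U$ and $q_k$ a path in $V$ from $b$ to $a_k$. Products of paths follow the first path first, $\pi_1$ is multiplied accordingly, and for a path $p$ from $b$ to $a$ the isomorphism $\pi(p)\colon\pi_1(\cdot,a)\to\pi_1(\cdot,b)$ is $[r]\mapsto[p\cdot r\cdot p^{-1}]$. Let $U'$ be a disjoint copy of $U$, and let $C$ be the quotient space of the disjoint union $U'\sqcup V$ obtained by identifying the copy $A_0'\subset U'$ of $A_0$ with $A_0\subset V$; let $\sigma\colon C\to X$ be the obvious map, and denote by $b$ also the common image of $b\in V$ and of its copy $b'\in U'$ in $C$. For $k=1,\dots,m$ let $i_k\colon A_k\to V\to C$ be the inclusion, let $\widehat\imath_k\colon A_k\to U'\to C$ be the inclusion of the copy of $A_k$ in $U'$, let $p_k'$ be the copy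 of $p_k$ in $U'$, and put $$\theta_k=\pi(q_k)\circ(i_k)_*,\qquad \widehat\theta_k=\pi(p_k')\circ(\widehat\imath_k)_*\colon\ \pi_1(A_k,a_k)\longrightarrow\pi_1(C,b).$$ Let $F$ be the free group with $m$ generators $t_1,\dots,t_m$, and let $N$ be the normal closure in the free product $\pi_1(C,b)*F$ of the elements $\widehat\theta_k(\alpha)\bigl(t_k\,\theta_k(\alpha)\,t_k^{-1}\bigr)^{-1}$ with $1\le k\le m$ and $\alpha\in\pi_1(A_k,a_k)$. Then there is an isomorphism $$\bigl(\pi_1(C,b)*F\bigr)/N\ \longrightarrow\ \pi_1(X,b)$$ such that the corresponding homomorphism $\pi_1(C,b)*F\to\pi_1(X,b)$ is equal to $\sigma_*$ on $\pi_1(C,b)$ and maps $t_k$ to the class of the loop $p_k\cdot q_k^{-1}$ for every $k$. -/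

import Mathlib

noncomputable section

namespace VanKampen

/-- The fundamental group `π₁(X, x)` with the usual multiplication of homotopy classes of loops,
`[γ] * [δ] = [γ · δ]`, where `γ · δ` follows first `γ` and then `δ`. Mathlib's `FundamentalGroup`
multiplies in the opposite order (`FundamentalGroup.mul_def`), hence the `ᵐᵒᵖ`. -/
abbrev PiOne (X : Type*) [TopologicalSpace X] (x : X) : Type _ :=
  (FundamentalGroup X x)ᵐᵒᵖ

section General

variable {X Y : Type*} [TopologicalSpace X] [TopologicalSpace Y]

/-- The homotopy class in `π₁(X, x)` of a loop based at `x`. -/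
def loopClass {x : X} (γ : Path x x) : PiOne X x :=
  MulOpposite.op (FundamentalGroup.fromPath (Path.Homotopic.Quotient.mk γ))

theorem loopClass_trans {x : X} (γ δ : Path x x) :
    loopClass (γ.trans δ) = loopClass γ * loopClass δ := rfl

/-- The homomorphism `f_* : π₁(X, x) → π₁(Y, f x)` induced by a continuous map `f`. -/
def piOneMap (f : C(X, Y)) (x : X) : PiOne X x →* PiOne Y (f x) :=
  MonoidHom.op (FundamentalGroup.map f x)

theorem piOneMap_loopClass (f : C(X, Y)) {x : X} (γ : Path x x) :
    piOneMap f x (loopClass γ) = loopClass (γ.map f.continuous) := rfl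

/-- The change of base point `π(p) : π₁(X, a) → π₁(X, b)`, `[r] ↦ [p · r · p⁻¹]`,
along a path `p` from `b` to `a`. -/
def changeBase {b a : X} (p : Path b a) : PiOne X a →* PiOne X b :=
  MonoidHom.op (FundamentalGroup.fundamentalGroupMulEquivOfPath p).symm.toMonoidHom

theorem changeBase_loopClass {b a : X} (p : Path b a) (r : Path a a) :
    changeBase p (loopClass r) = loopClass (p.trans (r.trans p.symm)) := rfl

end General

section Gluing

variable {X : Type*} [TopologicalSpace X]

/-- The map from the disjoint union of (a copy of) `U` and `V` to `X`. -/
def sumToX (U V : Set X) : U ⊕ V → X :=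
  Sum.elim Subtype.val Subtype.val

/-- The equivalence relation on the disjoint union `U ⊔ V` that identifies the two copies of every
point of `B` and makes no other identification. -/
def glueSetoid (U V B : Set X) : Setoid (U ⊕ V) where
  r y z := y = z ∨ (sumToX U V y = sumToX U V z ∧ sumToX U V y ∈ B)
  iseqv :=
    { refl := fun _ => Or.inl rfl
      symm := by
        rintro y z (h | ⟨h, hB⟩)
        · exact Or.inl h.symm
        · exact Or.inr ⟨h.symm, h ▸ hB⟩
      trans := by
        rintro x y z (h | ⟨h, hB⟩) (h' | ⟨h', hB'⟩)
        · exact Or.inl (h.trans h')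
        · exact Or.inr ⟨by rw [h, h'], h ▸ hB'⟩
        · exact Or.inr ⟨by rw [h, h'], hB⟩
        · exact Or.inr ⟨h.trans h', hB⟩ }

/-- The space obtained from the disjoint union of a copy `U'` of `U` and of `V` by identifying the
copy of `B` in `U'` with `B ⊆ V`, with the quotient topology. -/
def Glue (U V B : Set X) : Type _ :=
  Quotient (glueSetoid U V B)

instance (U V B : Set X) : TopologicalSpace (Glue U V B) :=
  inferInstanceAs (TopologicalSpace (Quotient (glueSetoid U V B)))

/-- The canonical map `U → U' → C`. -/
def glueInl (U V B : Set X) : C(U, Glue U V B) where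
  toFun u := Quotient.mk (glueSetoid U V B) (Sum.inl u)
  continuous_toFun := continuous_quotient_mk'.comp continuous_inl

/-- The canonical map `V → C`. -/
def glueInr (U V B : Set X) : C(V, Glue U V B) where
  toFun v := Quotient.mk (glueSetoid U V B) (Sum.inr v)
  continuous_toFun := continuous_quotient_mk'.comp continuous_inr

theorem glueInl_eq_glueInr {U V B : Set X} {b : X} (hU : b ∈ U) (hV : b ∈ V) (hB : b ∈ B) :
    glueInr U V B ⟨b, hV⟩ = glueInl U V B ⟨b, hU⟩ :=
  Quotient.sound (Or.inr ⟨rfl, hB⟩)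

/-- The obvious map `σ : C → X`. -/
def glueToX (U V B : Set X) : C(Glue U V B, X) where
  toFun := Quotient.lift (sumToX U V) (by
    rintro y z (h | ⟨h, -⟩)
    · rw [h]
    · exact h)
  continuous_toFun :=
    (continuous_subtype_val.sumElim continuous_subtype_val).quotient_lift _

/-- The homomorphism `σ_* : π₁(C, b) → π₁(X, b)`; the base point of `C` is the image of `b ∈ V`. -/
def sigmaStar (U V B : Set X) {b : X} (hV : b ∈ V) :
    PiOne (Glue U V B) (glueInr U V B ⟨b, hV⟩) →* PiOne X b :=
  piOneMap (glueToX U V B) (glueInr U V B ⟨b, hV⟩)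

/-- The homomorphism `θ = π(q) ∘ i_* : π₁(A, a) → π₁(C, b)`, where `i : A → V → C` is the
inclusion and `q` is a path from `b` to `a` in `V`. -/
def theta (U V B : Set X) {A : Set X} {b a : X} (hV : b ∈ V) (hAV : A ⊆ V) (ha : a ∈ A)
    (q : Path (⟨b, hV⟩ : V) ⟨a, hAV ha⟩) :
    PiOne A ⟨a, ha⟩ →* PiOne (Glue U V B) (glueInr U V B ⟨b, hV⟩) :=
  (changeBase (q.map (glueInr U V B).continuous)).comp
    (piOneMap ((glueInr U V B).comp (ContinuousMap.inclusion hAV)) ⟨a, ha⟩)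

/-- The homomorphism `θ̂ = π(p') ∘ î_* : π₁(A, a) → π₁(C, b)`, where `î : A → A' ⊆ U' → C` is the
inclusion of the copy of `A` in `U'` and `p'` is the copy in `U'` of a path `p` from `b` to `a`
in `U`; the points `b ∈ V` and `b' ∈ U'` coincide in `C`, since `b ∈ B`. -/
def thetaHat (U V B : Set X) {A : Set X} {b a : X} (hU : b ∈ U) (hV : b ∈ V) (hB : b ∈ B)
    (hAU : A ⊆ U) (ha : a ∈ A) (p : Path (⟨b, hU⟩ : U) ⟨a, hAU ha⟩) :
    PiOne A ⟨a, ha⟩ →* PiOne (Glue U V B) (glueInr U V B ⟨b, hV⟩) :=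
  (changeBase ((p.map (glueInl U V B).continuous).cast (glueInl_eq_glueInr hU hV hB) rfl)).comp
    (piOneMap ((glueInl U V B).comp (ContinuousMap.inclusion hAU)) ⟨a, ha⟩)

end Gluing

/-- The path component of `U ∩ V` that contains the point `a ∈ U ∩ V`. -/
abbrev comp {X : Type*} [TopologicalSpace X] (U V : Set X) (a : X) : Set X :=
  pathComponentIn (U ∩ V) a

theorem comp_subset_left {X : Type*} [TopologicalSpace X] {U V : Set X} {a : X} :
    comp U V a ⊆ U :=
  pathComponentIn_subset.trans Set.inter_subset_left

theorem comp_subset_right {X : Type*} [TopologicalSpace X] {U V : Set X} {a : X} :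
    comp U V a ⊆ V :=
  pathComponentIn_subset.trans Set.inter_subset_right

theorem mem_comp {X : Type*} [TopologicalSpace X] {U V : Set X} {a : X} (ha : a ∈ U ∩ V) :
    a ∈ comp U V a :=
  mem_pathComponentIn_self ha

/-- Given homomorphisms `φ k, ψ k : H k → G`, the elements `φ k α * (t k * ψ k α * (t k)⁻¹)⁻¹` of
the free product of `G` and the free group on generators `t k`: to kill all of them is to impose
the relations `φ k α = t k * ψ k α * (t k)⁻¹`. -/
def hnnRelators {ι : Type*} {G : Type*} [Group G] {H : ι → Type*} [∀ k, Group (H k)]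
    (φ ψ : ∀ k, H k →* G) : Set (Monoid.Coprod G (FreeGroup ι)) :=
  {w | ∃ (k : ι) (α : H k), w =
    Monoid.Coprod.inl (φ k α) *
      (Monoid.Coprod.inr (FreeGroup.of k) * Monoid.Coprod.inl (ψ k α) *
        (Monoid.Coprod.inr (FreeGroup.of k))⁻¹)⁻¹}

/-- The free product of `G` and the free group on generators `t k`, with the relations
`φ k α = t k * ψ k α * (t k)⁻¹` imposed for all `k` and all `α`. -/
abbrev HNNQuotient {ι : Type*} {G : Type*} [Group G] {H : ι → Type*} [∀ k, Group (H k)]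
    (φ ψ : ∀ k, H k →* G) : Type _ :=
  Monoid.Coprod G (FreeGroup ι) ⧸ Subgroup.normalClosure (hnnRelators φ ψ)

/-- The canonical homomorphism from the free product onto its quotient. -/
abbrev HNNQuotient.proj {ι : Type*} {G : Type*} [Group G] {H : ι → Type*} [∀ k, Group (H k)]
    {φ ψ : ∀ k, H k →* G} : Monoid.Coprod G (FreeGroup ι) →* HNNQuotient φ ψ :=
  QuotientGroup.mk' (Subgroup.normalClosure (hnnRelators φ ψ))

end VanKampen

end

noncomputable section

namespace VanKampen

open Set
open scoped unitInterval

/-- A function on the paths of `X` with values in a group that is invariant under homotopies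
relative to the end points and takes products of paths to products. -/
structure PathCocycle (X G : Type*) [TopologicalSpace X] [Group G] where
  /-- The value on a path, regarded as a continuous map. -/
  toFun : C(I, X) → G
  map_homotopic : ∀ {x y : X} {γ δ : Path x y}, γ.Homotopic δ →
    toFun γ.toContinuousMap = toFun δ.toContinuousMap
  map_trans : ∀ {x y z : X} (γ : Path x y) (δ : Path y z),
    toFun (γ.trans δ).toContinuousMap = toFun γ.toContinuousMap * toFun δ.toContinuousMap

/-- A continuous map on the unit interval, regarded as a path. -/
def toPath {X : Type*} [TopologicalSpace X] (f : C(I, X)) : Path (f 0) (f 1) :=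
  ⟨f, rfl, rfl⟩

namespace PathCocycle

variable {X Y G H : Type*} [TopologicalSpace X] [TopologicalSpace Y] [Group G] [Group H]

instance : CoeFun (PathCocycle X G) (fun _ => C(I, X) → G) := ⟨toFun⟩

theorem map_refl (c : PathCocycle X G) (x : X) : c (Path.refl x).toContinuousMap = 1 := by
  have h := c.map_trans (Path.refl x) (Path.refl x)
  rw [Path.refl_trans_refl] at h
  exact left_eq_mul.mp h

theorem map_symm (c : PathCocycle X G) {x y : X} (γ : Path x y) :
    c γ.symm.toContinuousMap = (c γ.toContinuousMap)⁻¹ := by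
  rw [eq_inv_iff_mul_eq_one, ← c.map_trans, ← c.map_refl y]
  exact c.map_homotopic ⟨(Path.Homotopy.reflSymmTrans γ).symm⟩

/-- The pull-back of a cocycle along a continuous map. -/
def pull (c : PathCocycle X G) (g : C(Y, X)) : PathCocycle Y G where
  toFun f := c (g.comp f)
  map_homotopic h := c.map_homotopic (h.map g)
  map_trans γ δ := by
    have := c.map_trans (γ.map g.continuous) (δ.map g.continuous)
    rw [← Path.map_trans] at this
    exact this

theorem pull_apply (c : PathCocycle X G) (g : C(Y, X)) (f : C(I, Y)) :
    c.pull g f = c (g.comp f) := rfl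

/-- The image of a cocycle under a group homomorphism. -/
def push (c : PathCocycle X G) (φ : G →* H) : PathCocycle X H where
  toFun f := φ (c f)
  map_homotopic h := by rw [c.map_homotopic h]
  map_trans γ δ := by rw [c.map_trans, map_mul]

theorem push_apply (c : PathCocycle X G) (φ : G →* H) (f : C(I, X)) :
    c.push φ f = φ (c f) := rfl

/-- The cocycle cohomologous to `c` by means of `s`. -/
def twist (c : PathCocycle X G) (s : X → G) : PathCocycle X G where
  toFun f := (s (f 0))⁻¹ * c f * s (f 1)
  map_homotopic {x y γ δ} h := by
    simp only [Path.coe_toContinuousMap, Path.source, Path.target, c.map_homotopic h]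
  map_trans γ δ := by
    simp only [Path.coe_toContinuousMap, Path.source, Path.target, c.map_trans]
    group

theorem twist_apply (c : PathCocycle X G) (s : X → G) (f : C(I, X)) :
    c.twist s f = (s (f 0))⁻¹ * c f * s (f 1) := rfl

theorem map_comp_mul [SimplyConnectedSpace Y] (c : PathCocycle X G) (g : C(Y, X)) {x y z : Y}
    (α : Path x y) (β : Path y z) (γ : Path x z) :
    c (g.comp γ.toContinuousMap) =
      c (g.comp α.toContinuousMap) * c (g.comp β.toContinuousMap) := by
  rw [← pull_apply, ← pull_apply, ← pull_apply, ← map_trans]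
  exact (c.pull g).map_homotopic (SimplyConnectedSpace.paths_homotopic _ _)

theorem exists_path_Icc {a b : I} (h : a ≤ b) : ∃ γ : Path a b, ∀ t, γ t ∈ Icc a b := by
  have key : ∀ t : I, AffineMap.lineMap (a : ℝ) (b : ℝ) (t : ℝ) ∈ Icc (a : ℝ) b := fun t => by
    rw [← segment_eq_Icc (show (a : ℝ) ≤ b from h), segment_eq_image_lineMap]
    exact ⟨t, t.2, rfl⟩
  refine ⟨⟨⟨fun t => ⟨AffineMap.lineMap (a : ℝ) (b : ℝ) (t : ℝ),
    a.2.1.trans (key t).1, (key t).2.trans b.2.2⟩, ?_⟩, ?_, ?_⟩, key⟩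
  · exact Continuous.subtype_mk (AffineMap.lineMap_continuous.comp continuous_subtype_val) _
  · ext; simp
  · ext; simp

instance : ContractibleSpace I :=
  (convex_Icc (0 : ℝ) 1).contractibleSpace ⟨0, by simp⟩

/-- Two cocycles agree on a path if they agree on the pieces of the path that are subordinate to an
open cover of the interval. -/
theorem eq_of_open_cover (c c' : PathCocycle X G) (f : C(I, X)) {ι : Type*} (s : ι → Set I)
    (hs : ∀ i, IsOpen (s i)) (hcov : ∀ t, ∃ i, t ∈ s i)
    (h : ∀ i, ∀ g : C(I, I), (∀ t, g t ∈ s i) → c (f.comp g) = c' (f.comp g)) : c f = c' f := by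
  obtain ⟨t, t0, tmono, ⟨n, hn⟩, ht⟩ :=
    exists_monotone_Icc_subset_open_cover_unitInterval hs (fun x _ => mem_iUnion.2 (hcov x))
  have key : ∀ n, ∀ γ : Path 0 (t n),
      c (f.comp γ.toContinuousMap) = c' (f.comp γ.toContinuousMap) := by
    intro n
    induction n with
    | zero =>
      rw [t0]
      intro γ
      have := c.map_comp_mul f γ γ γ
      have := c'.map_comp_mul f γ γ γ
      simp_all
    | succ n ih =>
      intro γ
      obtain ⟨δ, -⟩ := exists_path_Icc (show 0 ≤ t n from (t n).2.1)
      obtain ⟨ε, hε⟩ := exists_path_Icc (tmono n.le_succ)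
      obtain ⟨i, hi⟩ := ht n
      rw [c.map_comp_mul f δ ε, c'.map_comp_mul f δ ε, ih δ, h i _ fun x => hi (hε x)]
  have := key n
  rw [hn n le_rfl] at this
  exact this ⟨ContinuousMap.id I, rfl, rfl⟩

end PathCocycle

/-! ### Gluing cocycles along an open cover -/

section Gluing

variable {X G : Type*} [TopologicalSpace X] [Group G]

/-- A path of `X` that runs in `W`, as a path of `W`. -/
def restrictPath {Y : Type*} [TopologicalSpace Y] (W : Set X) (f : C(Y, X)) (h : ∀ t, f t ∈ W) :
    C(Y, W) :=
  ⟨fun t => ⟨f t, h t⟩, by fun_prop⟩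

variable {ι : Type*} {W : ι → Set X} (c : ∀ i, PathCocycle (W i) G)

open Classical in
/-- The value of a family of cocycles on the paths that run in one of the members of a cover. -/
def localValue (f : C(I, X)) : G :=
  if h : ∃ i, ∀ t, f t ∈ W i then c h.choose (restrictPath _ f h.choose_spec) else 1

/-- The members of a family of cocycles agree on the paths that run in two members of the cover. -/
def Compatible : Prop :=
  ∀ i j (f : C(I, X)) (hi : ∀ t, f t ∈ W i) (hj : ∀ t, f t ∈ W j),
    c i (restrictPath _ f hi) = c j (restrictPath _ f hj)

theorem localValue_eq {c : ∀ i, PathCocycle (W i) G} (hc : Compatible c) {f : C(I, X)} {i : ι}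
    (h : ∀ t, f t ∈ W i) : localValue c f = c i (restrictPath _ f h) := by
  have h' : ∃ i, ∀ t, f t ∈ W i := ⟨i, h⟩
  rw [localValue, dif_pos h']
  exact hc _ _ _ _ _

variable {E F : Type*} [NormedAddCommGroup E] [NormedSpace ℝ E]
  [NormedAddCommGroup F] [NormedSpace ℝ F]

/-- The linear path from `z` to `w`. -/
def seg (z w : E) : C(I, E) :=
  ⟨fun t => AffineMap.lineMap z w (t : ℝ),
    AffineMap.lineMap_continuous.comp continuous_subtype_val⟩

theorem seg_apply (z w : E) (t : I) : seg z w t = AffineMap.lineMap z w (t : ℝ) := rfl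

@[simp] theorem seg_zero (z w : E) : seg z w 0 = z := by simp [seg_apply]

@[simp] theorem seg_one (z w : E) : seg z w 1 = w := by simp [seg_apply]

theorem seg_mem {Z : Set E} (hZ : Convex ℝ Z) {z w : E} (hz : z ∈ Z) (hw : w ∈ Z) (t : I) :
    seg z w t ∈ Z :=
  hZ.segment_subset hz hw (by rw [segment_eq_image_lineMap]; exact ⟨t, t.2, rfl⟩)

theorem exists_seg_eq {z w y : E} (hy : y ∈ segment ℝ z w) : ∃ t : I, seg z w t = y := by
  rw [segment_eq_image_lineMap] at hy
  obtain ⟨t, ht, rfl⟩ := hy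
  exact ⟨⟨t, ht⟩, rfl⟩

theorem localValue_triangle {c : ∀ i, PathCocycle (W i) G} (hc : Compatible c) (f : C(E, X))
    {Z : Set E} (hZ : Convex ℝ Z) {i : ι} (hf : ∀ z ∈ Z, f z ∈ W i) {x y z : E}
    (hx : x ∈ Z) (hy : y ∈ Z) (hz : z ∈ Z) :
    localValue c (f.comp (seg x z)) =
      localValue c (f.comp (seg x y)) * localValue c (f.comp (seg y z)) := by
  have : ContractibleSpace Z := hZ.contractibleSpace ⟨x, hx⟩
  let p (a b : Z) : Path a b :=
    ⟨restrictPath Z (seg (a : E) b) (seg_mem hZ a.2 b.2), by ext; simp [restrictPath],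
      by ext; simp [restrictPath]⟩
  let g : C(Z, W i) := ⟨fun a => ⟨f a, hf a a.2⟩, by fun_prop⟩
  rw [localValue_eq hc fun t => hf _ (seg_mem hZ hx hz t),
    localValue_eq hc fun t => hf _ (seg_mem hZ hx hy t),
    localValue_eq hc fun t => hf _ (seg_mem hZ hy hz t)]
  exact (c i).map_comp_mul g (p ⟨x, hx⟩ ⟨y, hy⟩) (p ⟨y, hy⟩ ⟨z, hz⟩) (p ⟨x, hx⟩ ⟨z, hz⟩)

/-- `h` is a primitive of the family `c` along `f` on the set `Z`. -/
def IsPrimitiveOn (f : C(E, X)) (h : E → G) (Z : Set E) : Prop :=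
  ∀ z ∈ Z, ∀ w ∈ Z, ∀ i, (∀ t, f (seg z w t) ∈ W i) →
    h w = h z * localValue c (f.comp (seg z w))

variable {c}

theorem IsPrimitiveOn.mono {f : C(E, X)} {h : E → G} {Z Z' : Set E} (H : IsPrimitiveOn c f h Z)
    (hZ : Z' ⊆ Z) : IsPrimitiveOn c f h Z' :=
  fun z hz w hw => H z (hZ hz) w (hZ hw)

theorem IsPrimitiveOn.comp_affine {f : C(E, X)} {h : E → G} {Z : Set E}
    (H : IsPrimitiveOn c f h Z) (g : F →ᴬ[ℝ] E) (Z' : Set F) (hg : MapsTo g Z' Z)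
    (f' : C(F, X)) (hf' : ∀ z ∈ Z', f' z = f (g z)) (hZ' : Convex ℝ Z') :
    IsPrimitiveOn c f' (h ∘ g) Z' := by
  intro z hz w hw i hi
  have key : f'.comp (seg z w) = f.comp (seg (g z) (g w)) := by
    ext t
    simp only [ContinuousMap.comp_apply]
    rw [hf' _ (seg_mem hZ' hz hw t)]
    congr 1
    exact (g : F →ᵃ[ℝ] E).apply_lineMap z w t
  rw [key]
  refine H _ (hg hz) _ (hg hw) i fun t => ?_
  rw [← ContinuousMap.comp_apply, ← key]
  exact hi t

theorem exists_isPrimitiveOn_of_subset (hc : Compatible c) (f : C(E, X)) {Z : Set E}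
    (hZ : Convex ℝ Z) {i : ι} (hf : ∀ z ∈ Z, f z ∈ W i) : ∃ h, IsPrimitiveOn c f h Z := by
  rcases Z.eq_empty_or_nonempty with rfl | ⟨z₀, hz₀⟩
  · exact ⟨1, fun z hz => hz.elim⟩
  · exact ⟨fun z => localValue c (f.comp (seg z₀ z)), fun z hz w hw _ _ =>
      localValue_triangle hc f hZ hf hz₀ hz hw⟩

theorem IsPrimitiveOn.mul_inv_eq (hW : ∀ i, IsOpen (W i)) (hcov : ∀ x, ∃ i, x ∈ W i)
    {f : C(E, X)} {h h' : E → G} {Z : Set E} (hZ : Convex ℝ Z)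
    (H : IsPrimitiveOn c f h Z) (H' : IsPrimitiveOn c f h' Z) {z w : E} (hz : z ∈ Z)
    (hw : w ∈ Z) : h w * (h' w)⁻¹ = h z * (h' z)⁻¹ := by
  obtain ⟨t, t0, tmono, ⟨n, hn⟩, ht⟩ := exists_monotone_Icc_subset_open_cover_unitInterval
    (c := fun i => (f.comp (seg z w)) ⁻¹' W i) (fun i => (hW i).preimage (map_continuous _))
    (fun x _ => mem_iUnion.2 (hcov _))
  have key : ∀ n, h (seg z w (t n)) * (h' (seg z w (t n)))⁻¹ = h z * (h' z)⁻¹ := by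
    intro n
    induction n with
    | zero => rw [t0, seg_zero]
    | succ n ih =>
      obtain ⟨i, hi⟩ := ht n
      have hsub : ∀ s, f (seg (seg z w (t n)) (seg z w (t (n + 1))) s) ∈ W i := by
        intro s
        have hs : AffineMap.lineMap (t n : ℝ) (t (n + 1) : ℝ) (s : ℝ) ∈
            Icc (t n : ℝ) (t (n + 1)) := by
          rw [← segment_eq_Icc (show (t n : ℝ) ≤ t (n + 1) from tmono n.le_succ),
            segment_eq_image_lineMap]
          exact ⟨s, s.2, rfl⟩
        have := hi (a := ⟨_, (t n).2.1.trans hs.1, hs.2.trans (t (n + 1)).2.2⟩) hs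
        have e : seg (seg z w (t n)) (seg z w (t (n + 1))) s =
            AffineMap.lineMap z w (AffineMap.lineMap (t n : ℝ) (t (n + 1) : ℝ) (s : ℝ)) :=
          ((AffineMap.lineMap z w : ℝ →ᵃ[ℝ] E).apply_lineMap _ _ _).symm
        rw [e]
        exact this
      rw [H _ (seg_mem hZ hz hw _) _ (seg_mem hZ hz hw _) i hsub,
        H' _ (seg_mem hZ hz hw _) _ (seg_mem hZ hz hw _) i hsub, ← ih]
      group
  have := key n
  rwa [hn n le_rfl, seg_one] at this

theorem exists_isPrimitiveOn_union (hW : ∀ i, IsOpen (W i)) (hcov : ∀ x, ∃ i, x ∈ W i)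
    (hc : Compatible c) {f : C(E, X)} {h₁ h₂ : E → G}
    {Z₁ Z₂ : Set E} (hZ₁ : Convex ℝ Z₁) (hZ₂ : Convex ℝ Z₂) (hZ : Convex ℝ (Z₁ ∪ Z₂))
    (hZ₁c : IsClosed Z₁) (hZ₂c : IsClosed Z₂) (hne : (Z₁ ∩ Z₂).Nonempty)
    (H₁ : IsPrimitiveOn c f h₁ Z₁) (H₂ : IsPrimitiveOn c f h₂ Z₂) :
    ∃ h, IsPrimitiveOn c f h (Z₁ ∪ Z₂) := by
  classical
  obtain ⟨z₀, hz₀⟩ := hne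
  let h : E → G := fun z => if z ∈ Z₁ then h₁ z else h₁ z₀ * (h₂ z₀)⁻¹ * h₂ z
  have e₁ : ∀ z ∈ Z₁, h z = h₁ z := fun z hz => if_pos hz
  have e₂ : ∀ z ∈ Z₂, h z = h₁ z₀ * (h₂ z₀)⁻¹ * h₂ z := fun z hz => by
    by_cases hz' : z ∈ Z₁
    · rw [e₁ z hz', ← (H₁.mono inter_subset_left).mul_inv_eq hW hcov (hZ₁.inter hZ₂)
        (H₂.mono inter_subset_right) hz₀ ⟨hz', hz⟩]
      group
    · exact if_neg hz'
  have d₁ : ∀ z ∈ Z₁, ∀ w ∈ Z₁, ∀ i, (∀ t, f (seg z w t) ∈ W i) →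
      h w = h z * localValue c (f.comp (seg z w)) := fun z hz w hw i hi => by
    rw [e₁ z hz, e₁ w hw, H₁ z hz w hw i hi]
  have d₂ : ∀ z ∈ Z₂, ∀ w ∈ Z₂, ∀ i, (∀ t, f (seg z w t) ∈ W i) →
      h w = h z * localValue c (f.comp (seg z w)) := fun z hz w hw i hi => by
    rw [e₂ z hz, e₂ w hw, H₂ z hz w hw i hi]
    group
  have cross : ∀ z ∈ Z₁ ∪ Z₂, ∀ w ∈ Z₁ ∪ Z₂, (segment ℝ z w ∩ Z₁).Nonempty →
      (segment ℝ z w ∩ Z₂).Nonempty → ∃ y ∈ segment ℝ z w, y ∈ Z₁ ∩ Z₂ := by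
    intro z hz w hw n₁ n₂
    obtain ⟨y, hy⟩ := isPreconnected_closed_iff.1 (convex_segment z w).isPreconnected Z₁ Z₂
      hZ₁c hZ₂c (hZ.segment_subset hz hw) n₁ n₂
    exact ⟨y, hy⟩
  have small : ∀ {z w y : E} {i : ι}, y ∈ segment ℝ z w → (∀ t, f (seg z w t) ∈ W i) →
      localValue c (f.comp (seg z w)) =
        localValue c (f.comp (seg z y)) * localValue c (f.comp (seg y w)) ∧
      (∀ t, f (seg z y t) ∈ W i) ∧ (∀ t, f (seg y w t) ∈ W i) := by
    intro z w y i hy hi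
    have hf : ∀ x ∈ segment ℝ z w, f x ∈ W i := fun x hx => by
      obtain ⟨t, rfl⟩ := exists_seg_eq hx
      exact hi t
    have hz := left_mem_segment ℝ z w
    have hw := right_mem_segment ℝ z w
    have hs := convex_segment (𝕜 := ℝ) z w
    exact ⟨localValue_triangle hc f hs hf hz hy hw, fun t => hf _ (seg_mem hs hz hy t),
      fun t => hf _ (seg_mem hs hy hw t)⟩
  refine ⟨h, fun z hz w hw i hi => ?_⟩
  rcases hz with hz₁ | hz₂ <;> rcases hw with hw₁ | hw₂
  · exact d₁ z hz₁ w hw₁ i hi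
  · obtain ⟨y, hy, hy₁, hy₂⟩ := cross z (Or.inl hz₁) w (Or.inr hw₂)
      ⟨z, left_mem_segment ℝ z w, hz₁⟩ ⟨w, right_mem_segment ℝ z w, hw₂⟩
    obtain ⟨e, i₁, i₂⟩ := small hy hi
    rw [e, d₂ y hy₂ w hw₂ i i₂, d₁ z hz₁ y hy₁ i i₁, mul_assoc]
  · obtain ⟨y, hy, hy₁, hy₂⟩ := cross z (Or.inr hz₂) w (Or.inl hw₁)
      ⟨w, right_mem_segment ℝ z w, hw₁⟩ ⟨z, left_mem_segment ℝ z w, hz₂⟩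
    obtain ⟨e, i₁, i₂⟩ := small hy hi
    rw [e, d₁ y hy₁ w hw₁ i i₂, d₂ z hz₂ y hy₂ i i₁, mul_assoc]
  · exact d₂ z hz₂ w hw₂ i hi

theorem exists_isPrimitiveOn_square (hW : ∀ i, IsOpen (W i)) (hcov : ∀ x, ∃ i, x ∈ W i)
    (hc : Compatible c) (f : C(ℝ × ℝ, X)) :
    ∃ h, IsPrimitiveOn c f h (Icc (0 : ℝ) 1 ×ˢ Icc (0 : ℝ) 1) := by
  obtain ⟨t, t0, tmono, ⟨N, hN⟩, ht⟩ :=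
    exists_monotone_Icc_subset_open_cover_unitInterval_prod_self
      (c := fun i => (fun x : I × I => f (x.1, x.2)) ⁻¹' W i)
      (fun i => (hW i).preimage (by fun_prop)) (fun x _ => mem_iUnion.2 (hcov _))
  have ht' : ∀ n, (0 : ℝ) ≤ t n := fun n => (t n).2.1
  have hle : ∀ n, (t n : ℝ) ≤ t (n + 1) := fun n => tmono n.le_succ
  have cell : ∀ n m, ∃ h, IsPrimitiveOn c f h
      (Icc (t n : ℝ) (t (n + 1)) ×ˢ Icc (t m : ℝ) (t (m + 1))) := by
    intro n m
    obtain ⟨i, hi⟩ := ht n m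
    refine exists_isPrimitiveOn_of_subset hc f ((convex_Icc _ _).prod (convex_Icc _ _)) (i := i) ?_
    rintro ⟨x, y⟩ ⟨hx, hy⟩
    exact hi (a := (⟨x, (ht' n).trans hx.1, hx.2.trans (t (n + 1)).2.2⟩,
      ⟨y, (ht' m).trans hy.1, hy.2.trans (t (m + 1)).2.2⟩)) ⟨hx, hy⟩
  have row : ∀ m n, ∃ h, IsPrimitiveOn c f h
      (Icc (0 : ℝ) (t n) ×ˢ Icc (t m : ℝ) (t (m + 1))) := by
    intro m n
    induction n with
    | zero =>
      obtain ⟨h, H⟩ := cell 0 m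
      refine ⟨h, H.mono (prod_mono (Icc_subset_Icc ?_ (hle 0)) Subset.rfl)⟩
      rw [t0]; simp
    | succ n ih =>
      obtain ⟨h₁, H₁⟩ := ih
      obtain ⟨h₂, H₂⟩ := cell n m
      have hu : Icc (0 : ℝ) (t n) ×ˢ Icc (t m : ℝ) (t (m + 1)) ∪
          Icc (t n : ℝ) (t (n + 1)) ×ˢ Icc (t m : ℝ) (t (m + 1)) =
          Icc (0 : ℝ) (t (n + 1)) ×ˢ Icc (t m : ℝ) (t (m + 1)) := by
        rw [← union_prod, Icc_union_Icc_eq_Icc (ht' n) (hle n)]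
      rw [← hu]
      refine exists_isPrimitiveOn_union hW hcov hc ((convex_Icc _ _).prod (convex_Icc _ _))
        ((convex_Icc _ _).prod (convex_Icc _ _)) ?_ (isClosed_Icc.prod isClosed_Icc)
        (isClosed_Icc.prod isClosed_Icc) ?_ H₁ H₂
      · rw [hu]
        exact (convex_Icc _ _).prod (convex_Icc _ _)
      · exact ⟨((t n : ℝ), (t m : ℝ)), ⟨⟨ht' n, le_rfl⟩, le_rfl, hle m⟩, ⟨le_rfl, hle n⟩, le_rfl, hle m⟩
  have tall : ∀ m, ∃ h, IsPrimitiveOn c f h (Icc (0 : ℝ) 1 ×ˢ Icc (0 : ℝ) (t m)) := by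
    intro m
    have row' : ∀ m, ∃ h, IsPrimitiveOn c f h (Icc (0 : ℝ) 1 ×ˢ Icc (t m : ℝ) (t (m + 1))) := by
      intro m
      have := row m N
      rwa [hN N le_rfl] at this
    induction m with
    | zero =>
      obtain ⟨h, H⟩ := row' 0
      refine ⟨h, H.mono (prod_mono Subset.rfl (Icc_subset_Icc ?_ (hle 0)))⟩
      rw [t0]; simp
    | succ m ih =>
      obtain ⟨h₁, H₁⟩ := ih
      obtain ⟨h₂, H₂⟩ := row' m
      have hu : Icc (0 : ℝ) 1 ×ˢ Icc (0 : ℝ) (t m) ∪ Icc (0 : ℝ) 1 ×ˢ Icc (t m : ℝ) (t (m + 1)) =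
          Icc (0 : ℝ) 1 ×ˢ Icc (0 : ℝ) (t (m + 1)) := by
        rw [← prod_union, Icc_union_Icc_eq_Icc (ht' m) (hle m)]
      rw [← hu]
      refine exists_isPrimitiveOn_union hW hcov hc ((convex_Icc _ _).prod (convex_Icc _ _))
        ((convex_Icc _ _).prod (convex_Icc _ _)) ?_ (isClosed_Icc.prod isClosed_Icc)
        (isClosed_Icc.prod isClosed_Icc) ?_ H₁ H₂
      · rw [hu]
        exact (convex_Icc _ _).prod (convex_Icc _ _)
      · exact ⟨((0 : ℝ), (t m : ℝ)), ⟨⟨le_rfl, zero_le_one⟩, ht' m, le_rfl⟩, ⟨le_rfl, zero_le_one⟩, le_rfl,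
          hle m⟩
  have := tall N
  rwa [hN N le_rfl] at this

/-- The extension of a path to the real line. -/
def extendLine (f : C(I, X)) : C(ℝ, X) := ⟨fun x => f (projIcc 0 1 zero_le_one x), by fun_prop⟩

theorem exists_isPrimitiveOn_Icc (hW : ∀ i, IsOpen (W i)) (hcov : ∀ x, ∃ i, x ∈ W i)
    (hc : Compatible c) (f : C(I, X)) :
    ∃ h, IsPrimitiveOn c (extendLine f) h (Icc (0 : ℝ) 1) := by
  obtain ⟨h, H⟩ := exists_isPrimitiveOn_square hW hcov hc
    ((extendLine f).comp (⟨Prod.fst, continuous_fst⟩ : C(ℝ × ℝ, ℝ)))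
  refine ⟨_, H.comp_affine (ContinuousLinearMap.inl ℝ ℝ ℝ).toContinuousAffineMap (Icc 0 1) ?_
    (extendLine f) (fun z _ => rfl) (convex_Icc _ _)⟩
  intro z hz
  exact ⟨hz, by simp⟩

theorem exists_value (hW : ∀ i, IsOpen (W i)) (hcov : ∀ x, ∃ i, x ∈ W i)
    (hc : Compatible c) (f : C(I, X)) :
    ∃ g : G, ∀ (f' : C(ℝ × ℝ, X)) (h : ℝ × ℝ → G) (Z : Set (ℝ × ℝ)), Convex ℝ Z →
      IsPrimitiveOn c f' h Z → ∀ z ∈ Z, ∀ w ∈ Z, f'.comp (seg z w) = f → h w = h z * g := by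
  obtain ⟨h₀, H₀⟩ := exists_isPrimitiveOn_Icc hW hcov hc f
  refine ⟨(h₀ 0)⁻¹ * h₀ 1, fun f' h Z hZ H z hz w hw hf => ?_⟩
  have H' : IsPrimitiveOn c (extendLine f) (h ∘ ContinuousAffineMap.lineMap z w) (Icc (0 : ℝ) 1) := by
    refine H.comp_affine (ContinuousAffineMap.lineMap z w) _ (fun t ht => seg_mem hZ hz hw ⟨t, ht⟩)
      _ (fun t ht => ?_) (convex_Icc _ _)
    subst hf
    change f' (seg z w (projIcc 0 1 zero_le_one t)) = _
    rw [projIcc_of_mem _ ht]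
    rfl
  have := H'.mul_inv_eq hW hcov (convex_Icc _ _) H₀ (z := 0) (w := 1) (by simp) (by simp)
  have l₀ : ContinuousAffineMap.lineMap z w (0 : ℝ) = z := AffineMap.lineMap_apply_zero z w
  have l₁ : ContinuousAffineMap.lineMap z w (1 : ℝ) = w := AffineMap.lineMap_apply_one z w
  simp only [Function.comp_apply, l₀, l₁] at this
  rw [← mul_assoc, ← this]
  group

/-- The extension of a continuous map on the unit square to the plane. -/
def extendPlane (f : C(I × I, X)) : C(ℝ × ℝ, X) :=
  ⟨fun x => f (projIcc 0 1 zero_le_one x.1, projIcc 0 1 zero_le_one x.2), by fun_prop⟩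

theorem extendPlane_seg (f : C(I × I, X)) (x₁ x₂ y₁ y₂ : I) (γ : C(I, X))
    (h : ∀ t : I, γ t = f (projIcc 0 1 zero_le_one (AffineMap.lineMap (x₁ : ℝ) y₁ (t : ℝ)),
      projIcc 0 1 zero_le_one (AffineMap.lineMap (x₂ : ℝ) y₂ (t : ℝ)))) :
    (extendPlane f).comp (seg ((x₁ : ℝ), (x₂ : ℝ)) (y₁, y₂)) = γ := by
  ext t
  rw [h t]
  simp [extendPlane, seg_apply]

/-- Cocycles on the members of an open cover that agree on the overlaps come from a cocycle on the
whole space. -/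
theorem exists_glued_cocycle (hW : ∀ i, IsOpen (W i)) (hcov : ∀ x, ∃ i, x ∈ W i)
    (hc : Compatible c) :
    ∃ C : PathCocycle X G, ∀ i (f : C(I, W i)),
      C ((⟨Subtype.val, continuous_subtype_val⟩ : C(W i, X)).comp f) = c i f := by
  choose v hv using exists_value hW hcov hc
  have sq : Convex ℝ (Icc (0 : ℝ) 1 ×ˢ Icc (0 : ℝ) 1) := (convex_Icc _ _).prod (convex_Icc _ _)
  have key : ∀ f : C(I × I, X), ∃ h : I × I → G, ∀ (x₁ x₂ y₁ y₂ : I) (γ : C(I, X)),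
      (∀ t : I, γ t = f (projIcc 0 1 zero_le_one (AffineMap.lineMap (x₁ : ℝ) y₁ (t : ℝ)),
        projIcc 0 1 zero_le_one (AffineMap.lineMap (x₂ : ℝ) y₂ (t : ℝ)))) →
      h (y₁, y₂) = h (x₁, x₂) * v γ := by
    intro f
    obtain ⟨h, H⟩ := exists_isPrimitiveOn_square hW hcov hc (extendPlane f)
    exact ⟨fun x => h (x.1, x.2), fun x₁ x₂ y₁ y₂ γ hγ =>
      hv γ _ h _ sq H _ ⟨x₁.2, x₂.2⟩ _ ⟨y₁.2, y₂.2⟩ (extendPlane_seg f x₁ x₂ y₁ y₂ γ hγ)⟩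
  have htrans : ∀ {x y z : X} (γ : Path x y) (δ : Path y z),
      v (γ.trans δ).toContinuousMap = v γ.toContinuousMap * v δ.toContinuousMap := by
    intro x y z γ δ
    obtain ⟨h, H⟩ := key ((γ.trans δ).toContinuousMap.comp ⟨Prod.fst, continuous_fst⟩)
    have half : (1 / 2 : ℝ) ∈ I := by constructor <;> norm_num
    have e₁ := H 0 0 1 0 (γ.trans δ).toContinuousMap (fun t => by
      simp [AffineMap.lineMap_apply])
    have e₂ := H 0 0 ⟨1 / 2, half⟩ 0 γ.toContinuousMap (fun t => by
      have ht : (t : ℝ) * (1 / 2) ∈ I := ⟨by have := t.2.1; linarith, by have := t.2.2; linarith⟩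
      have : (t : ℝ) * (1 / 2) ≤ 1 / 2 := by have := t.2.2; linarith
      simp only [Path.coe_toContinuousMap, ContinuousMap.comp_apply, ContinuousMap.coe_mk,
        AffineMap.lineMap_apply, Icc.coe_zero, vsub_eq_sub, sub_zero, smul_eq_mul, vadd_eq_add,
        add_zero, projIcc_of_mem _ ht, Path.trans_apply, dif_pos this]
      congr 1
      ext
      push_cast
      ring)
    have e₃ := H ⟨1 / 2, half⟩ 0 1 0 δ.toContinuousMap (fun t => by
      have ht : (t : ℝ) * (1 - 1 / 2) + 1 / 2 ∈ I :=
        ⟨by have := t.2.1; linarith, by have := t.2.2; linarith⟩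
      simp only [Path.coe_toContinuousMap, ContinuousMap.comp_apply, ContinuousMap.coe_mk,
        AffineMap.lineMap_apply, Icc.coe_one, vsub_eq_sub, smul_eq_mul, vadd_eq_add,
        projIcc_of_mem _ ht]
      rw [Path.trans_apply]
      split_ifs with hle
      · have ht0 : t = 0 := by
          ext
          have := t.2.1
          push_cast at hle ⊢
          linarith
        subst ht0
        simp only [Path.source]
        refine γ.target.symm.trans (congrArg γ ?_)
        ext
        push_cast
        norm_num
      · congr 1
        ext
        push_cast
        ring)
    rw [e₁, e₂, mul_assoc] at e₃
    exact mul_left_cancel e₃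
  have hrefl : ∀ x : X, v (Path.refl x).toContinuousMap = 1 := by
    intro x
    have h := htrans (Path.refl x) (Path.refl x)
    rw [Path.refl_trans_refl] at h
    exact left_eq_mul.mp h
  refine ⟨⟨v, ?_, htrans⟩, ?_⟩
  · rintro x y γ δ ⟨F⟩
    obtain ⟨h, H⟩ := key F.toContinuousMap
    have e₁ := H 0 0 0 1 γ.toContinuousMap (fun t => by simp [AffineMap.lineMap_apply])
    have e₂ := H 1 0 1 1 δ.toContinuousMap (fun t => by simp [AffineMap.lineMap_apply])
    have e₃ := H 0 0 1 0 (Path.refl x).toContinuousMap (fun t => by simp [AffineMap.lineMap_apply])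
    have e₄ := H 0 1 1 1 (Path.refl y).toContinuousMap (fun t => by simp [AffineMap.lineMap_apply])
    rw [hrefl, mul_one] at e₃ e₄
    rw [e₄, e₁, e₃] at e₂
    exact mul_left_cancel e₂
  · intro i f
    set f' := (⟨Subtype.val, continuous_subtype_val⟩ : C(W i, X)).comp f
    obtain ⟨h, H⟩ := exists_isPrimitiveOn_square hW hcov hc
      (extendPlane (f'.comp (⟨Prod.fst, continuous_fst⟩ : C(I × I, I))))
    have e : (extendPlane (f'.comp (⟨Prod.fst, continuous_fst⟩ : C(I × I, I)))).comp
        (seg (((0 : I) : ℝ), ((0 : I) : ℝ)) (((1 : I) : ℝ), ((0 : I) : ℝ))) = f' :=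
      extendPlane_seg _ _ _ _ _ _ (fun t => by simp [AffineMap.lineMap_apply])
    have m₀ : (((0 : I) : ℝ), ((0 : I) : ℝ)) ∈ Icc (0 : ℝ) 1 ×ˢ Icc (0 : ℝ) 1 := by simp
    have m₁ : (((1 : I) : ℝ), ((0 : I) : ℝ)) ∈ Icc (0 : ℝ) 1 ×ˢ Icc (0 : ℝ) 1 := by simp
    have h₁ := hv f' _ h _ sq H _ m₀ _ m₁ e
    have h₂ := H _ m₀ _ m₁ i (fun t => by
      rw [← ContinuousMap.comp_apply, e]
      exact (f t).2)
    rw [e, h₁] at h₂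
    change v f' = _
    rw [mul_left_cancel h₂, localValue_eq hc (i := i) fun t => (f t).2]
    rfl

end Gluing

/-! ### Cocycles and fundamental groups -/

section FundamentalGroup

variable {X Y G H : Type*} [TopologicalSpace X] [TopologicalSpace Y] [Group G] [Group H]

theorem loopClass_surjective (b : X) : Function.Surjective (loopClass (x := b)) := by
  intro g
  obtain ⟨γ, hγ⟩ := Path.Homotopic.Quotient.mk_surjective (FundamentalGroup.toPath g.unop)
  exact ⟨γ, congrArg MulOpposite.op hγ⟩

theorem loopClass_eq_of_homotopic {b : X} {γ δ : Path b b} (h : γ.Homotopic δ) :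
    loopClass γ = loopClass δ :=
  congrArg MulOpposite.op (Path.Homotopic.Quotient.eq.2 h)

theorem homotopic_of_loopClass_eq {b : X} {γ δ : Path b b} (h : loopClass γ = loopClass δ) :
    γ.Homotopic δ :=
  Path.Homotopic.Quotient.eq.1 (MulOpposite.op_injective h)

namespace PathCocycle

theorem twist_path (c : PathCocycle X G) (s : X → G) {x y : X} (γ : Path x y) :
    c.twist s γ.toContinuousMap = (s x)⁻¹ * c γ.toContinuousMap * s y := by
  simp only [twist_apply, Path.coe_toContinuousMap, Path.source, Path.target]

/-- The homomorphism on the fundamental group defined by a cocycle. -/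
def hom (c : PathCocycle X G) (b : X) : PiOne X b →* G where
  toFun g := c (Function.surjInv (loopClass_surjective b) g).toContinuousMap
  map_one' := by
    rw [← c.map_refl b]
    refine c.map_homotopic (homotopic_of_loopClass_eq ?_)
    rw [Function.surjInv_eq (loopClass_surjective b)]
    rfl
  map_mul' g h := by
    rw [← c.map_trans]
    refine c.map_homotopic (homotopic_of_loopClass_eq ?_)
    simp only [loopClass_trans, Function.surjInv_eq (loopClass_surjective b)]

theorem hom_loopClass (c : PathCocycle X G) {b : X} (γ : Path b b) :
    c.hom b (loopClass γ) = c γ.toContinuousMap :=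
  c.map_homotopic (homotopic_of_loopClass_eq (Function.surjInv_eq _ _))

end PathCocycle

theorem monoidHom_ext_loopClass {b : X} {φ ψ : PiOne X b →* G}
    (h : ∀ γ : Path b b, φ (loopClass γ) = ψ (loopClass γ)) : φ = ψ := by
  ext g
  obtain ⟨γ, rfl⟩ := loopClass_surjective b g
  exact h γ

/-- On a path-connected space there is a cocycle that takes every loop to its class. -/
theorem exists_cocycle_loopClass [PathConnectedSpace X] (b : X) :
    ∃ κ : PathCocycle X (PiOne X b), ∀ γ : Path b b, κ γ.toContinuousMap = loopClass γ := by
  have : ∀ x : X, ∃ w : Path b x, ∀ h : x = b, w = (Path.refl b).cast rfl h := by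
    intro x
    by_cases h : x = b
    · exact ⟨(Path.refl b).cast rfl h, fun _ => rfl⟩
    · exact ⟨PathConnectedSpace.somePath b x, fun h' => (h h').elim⟩
  choose w hw using this
  let v : C(I, X) → PiOne X b := fun f =>
    loopClass ((w (f 0)).trans ((toPath f).trans (w (f 1)).symm))
  have hv : ∀ {x y : X} (γ : Path x y),
      v γ.toContinuousMap = loopClass ((w x).trans (γ.trans (w y).symm)) := by
    rintro x y ⟨f, rfl, rfl⟩
    rfl
  refine ⟨⟨v, ?_, ?_⟩, ?_⟩
  · intro x y γ δ h
    rw [hv, hv]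
    exact loopClass_eq_of_homotopic ((Path.Homotopic.refl _).hcomp (h.hcomp (Path.Homotopic.refl _)))
  · intro x y z γ δ
    rw [hv, hv, hv, ← loopClass_trans]
    refine loopClass_eq_of_homotopic (Path.Homotopic.Quotient.eq.1 ?_)
    let W (x : X) : FundamentalGroupoid.mk b ⟶ FundamentalGroupoid.mk x :=
      Path.Homotopic.Quotient.mk (w x)
    let P : FundamentalGroupoid.mk x ⟶ FundamentalGroupoid.mk y := Path.Homotopic.Quotient.mk γ
    let R : FundamentalGroupoid.mk y ⟶ FundamentalGroupoid.mk z := Path.Homotopic.Quotient.mk δ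
    open CategoryTheory in
    have key : W x ≫ (P ≫ R) ≫ Groupoid.inv (W z) =
        (W x ≫ P ≫ Groupoid.inv (W y)) ≫ (W y ≫ R ≫ Groupoid.inv (W z)) := by
      simp
    exact key
  · intro γ
    change v γ.toContinuousMap = _
    rw [hv, hw b rfl]
    refine loopClass_eq_of_homotopic ?_
    exact Path.Homotopic.trans ⟨Path.Homotopy.reflTrans _⟩ ⟨Path.Homotopy.transRefl γ⟩

/-- Two cocycles on a path-connected space that agree on the loops at a point are cohomologous. -/
theorem exists_eq_twist [PathConnectedSpace X] (b : X) (c c' : PathCocycle X G)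
    (h : ∀ γ : Path b b, c γ.toContinuousMap = c' γ.toContinuousMap) :
    ∃ e : X → G, e b = 1 ∧ ∀ {x y : X} (γ : Path x y),
      c γ.toContinuousMap = (e x)⁻¹ * c' γ.toContinuousMap * e y := by
  let w (x : X) : Path b x := PathConnectedSpace.somePath b x
  refine ⟨fun x => (c' (w x).toContinuousMap)⁻¹ * c (w x).toContinuousMap, ?_, ?_⟩
  · simp only [h (w b), inv_mul_cancel]
  · intro x y γ
    have := h ((w x).trans (γ.trans (w y).symm))
    rw [c.map_trans, c.map_trans, c.map_symm, c'.map_trans, c'.map_trans, c'.map_symm] at this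
    calc c γ.toContinuousMap = (c (w x).toContinuousMap)⁻¹ * (c (w x).toContinuousMap *
          (c γ.toContinuousMap * (c (w y).toContinuousMap)⁻¹)) * c (w y).toContinuousMap := by group
      _ = _ := by rw [this]; group

end FundamentalGroup

/-! ### Paths in the glued space -/

section Glue

variable {X : Type*} [TopologicalSpace X] {U V : Set X}

theorem glue_cases {B : Set X} (z : Glue U V B) :
    z ∈ range (glueInl U V B) ∨ z ∈ range (glueInr U V B) := by
  induction z using Quotient.ind with
  | _ z => rcases z with u | v
           · exact Or.inl ⟨u, rfl⟩
           · exact Or.inr ⟨v, rfl⟩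

theorem isOpen_range_glueInl_union {B L : Set X} (hL : IsClosed L) (hBL : Disjoint B L) :
    IsOpen (range (glueInl U V B) ∪ glueToX U V B ⁻¹' Lᶜ) := by
  refine isOpen_coinduced.2 (isOpen_sum_iff.2 ⟨?_, ?_⟩)
  · convert isOpen_univ
    exact eq_univ_of_forall fun u => Or.inl ⟨u, rfl⟩
  · convert hL.isOpen_compl.preimage (continuous_subtype_val (p := (· ∈ V))) using 1
    ext v
    refine ⟨?_, fun h => Or.inr h⟩
    rintro (⟨u, hu⟩ | h)
    · rcases Quotient.exact hu with h | ⟨h, hB⟩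
      · cases h
      · have hv : (v : X) ∈ B := by
          rw [h] at hB
          exact hB
        exact fun hvL => Set.disjoint_left.1 hBL hv hvL
    · exact h

theorem isOpen_range_glueInr_union {B L : Set X} (hL : IsClosed L) (hBL : Disjoint B L) :
    IsOpen (range (glueInr U V B) ∪ glueToX U V B ⁻¹' Lᶜ) := by
  refine isOpen_coinduced.2 (isOpen_sum_iff.2 ⟨?_, ?_⟩)
  · convert hL.isOpen_compl.preimage (continuous_subtype_val (p := (· ∈ U))) using 1
    ext v
    refine ⟨?_, fun h => Or.inr h⟩
    rintro (⟨u, hu⟩ | h)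
    · rcases Quotient.exact hu with h | ⟨h, hB⟩
      · cases h
      · have hv : (v : X) ∈ B := by
          rw [h] at hB
          exact hB
        exact fun hvL => Set.disjoint_left.1 hBL hv hvL
    · exact h
  · convert isOpen_univ
    exact eq_univ_of_forall fun u => Or.inl ⟨u, rfl⟩

theorem mem_comp_of_path {a : X} (F : C(I, X)) {s : Set I} (hs : IsPathConnected s)
    (hF : ∀ t ∈ s, F t ∈ U ∩ V) {t₀ t : I} (ht₀ : t₀ ∈ s) (h₀ : F t₀ ∈ comp U V a) (ht : t ∈ s) :
    F t ∈ comp U V a := by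
  have h : JoinedIn (U ∩ V) (F t₀) (F t) :=
    ((hs.joinedIn t₀ ht₀ t ht).map_continuousOn F.continuous.continuousOn).mono (by
      rintro _ ⟨t, ht, rfl⟩
      exact hF t ht)
  exact JoinedIn.trans h₀ h

theorem exists_closed_of_path (hU : IsOpen U) (hV : IsOpen V) {a : X}
    (hB : IsOpen (comp U V a) ∨ T2Space X) (F : C(I, X)) :
    ∃ L : Set X, IsClosed L ∧ Disjoint (comp U V a) L ∧ ∀ t, F t ∉ comp U V a → F t ∈ L := by
  rcases hB with hB | hX
  · exact ⟨(comp U V a)ᶜ, hB.isClosed_compl, disjoint_compl_right, fun t ht => ht⟩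
  · have : LocallyPathConnectedSpace I := (convex_Icc (0 : ℝ) 1).locallyPathConnectedSpace
    have hO : IsOpen (F ⁻¹' (U ∩ V)) := (hU.inter hV).preimage F.continuous
    have hD : IsOpen (F ⁻¹' comp U V a) := by
      rw [isOpen_iff_mem_nhds]
      intro t ht
      have htO : t ∈ F ⁻¹' (U ∩ V) := (pathComponentIn_subset : comp U V a ⊆ U ∩ V) ht
      refine Filter.mem_of_superset
        ((hO.pathComponentIn t).mem_nhds (mem_pathComponentIn_self htO)) fun s hs => ?_
      exact mem_comp_of_path F (isPathConnected_pathComponentIn htO)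
        (fun r hr => (pathComponentIn_subset : _ ⊆ F ⁻¹' (U ∩ V)) hr) (mem_pathComponentIn_self htO) ht hs
    refine ⟨F '' (F ⁻¹' comp U V a)ᶜ, ?_, ?_, fun t ht => ⟨t, ht, rfl⟩⟩
    · exact (hD.isClosed_compl.isCompact.image F.continuous).isClosed
    · rw [Set.disjoint_left]
      rintro _ h ⟨t, ht, rfl⟩
      exact ht h

theorem glue_mem_ranges {B : Set X} (hBU : B ⊆ U) (hBV : B ⊆ V) {z : Glue U V B}
    (h : glueToX U V B z ∈ B) : z ∈ range (glueInl U V B) ∧ z ∈ range (glueInr U V B) := by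
  rcases glue_cases z with ⟨u, rfl⟩ | ⟨v, rfl⟩
  · exact ⟨⟨u, rfl⟩, ⟨⟨u, hBV h⟩, glueInl_eq_glueInr u.2 (hBV h) h⟩⟩
  · exact ⟨⟨⟨v, hBU h⟩, (glueInl_eq_glueInr (hBU h) v.2 h).symm⟩, ⟨v, rfl⟩⟩

/-- The preimages of the two parts of the glued space under a path are open, although the parts
themselves need not be. -/
theorem isOpen_preimage_range (hU : IsOpen U) (hV : IsOpen V) {a : X}
    (hB : IsOpen (comp U V a) ∨ T2Space X) (f : C(I, Glue U V (comp U V a))) :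
    IsOpen (f ⁻¹' range (glueInl U V (comp U V a))) ∧
      IsOpen (f ⁻¹' range (glueInr U V (comp U V a))) := by
  obtain ⟨L, hL, hBL, h⟩ :=
    exists_closed_of_path hU hV hB ((glueToX U V (comp U V a)).comp f)
  have key : ∀ t, glueToX U V (comp U V a) (f t) ∈ Lᶜ →
      glueToX U V (comp U V a) (f t) ∈ comp U V a := fun t ht => by
    by_contra hn
    exact ht (h t hn)
  constructor
  · convert (isOpen_range_glueInl_union hL hBL).preimage f.continuous using 1
    ext t
    refine ⟨fun ht => Or.inl ht, ?_⟩
    rintro (ht | ht)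
    · exact ht
    · exact (glue_mem_ranges comp_subset_left comp_subset_right (key t ht)).1
  · convert (isOpen_range_glueInr_union hL hBL).preimage f.continuous using 1
    ext t
    refine ⟨fun ht => Or.inl ht, ?_⟩
    rintro (ht | ht)
    · exact ht
    · exact (glue_mem_ranges comp_subset_left comp_subset_right (key t ht)).2

theorem exists_eq_glueInl_comp {B : Set X} {f : C(I, Glue U V B)}
    (h : ∀ t, f t ∈ range (glueInl U V B)) : ∃ g : C(I, U), f = (glueInl U V B).comp g := by
  have hU : ∀ t, glueToX U V B (f t) ∈ U := fun t => by
    obtain ⟨u, hu⟩ := h t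
    rw [← hu]
    exact u.2
  refine ⟨restrictPath U ((glueToX U V B).comp f) hU, ?_⟩
  ext t
  obtain ⟨u, hu⟩ := h t
  change f t = glueInl U V B ⟨glueToX U V B (f t), hU t⟩
  have : (⟨glueToX U V B (f t), hU t⟩ : U) = u :=
    Subtype.ext (congrArg (glueToX U V B) hu.symm)
  rw [this, hu]

theorem exists_eq_glueInr_comp {B : Set X} {f : C(I, Glue U V B)}
    (h : ∀ t, f t ∈ range (glueInr U V B)) : ∃ g : C(I, V), f = (glueInr U V B).comp g := by
  have hV : ∀ t, glueToX U V B (f t) ∈ V := fun t => by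
    obtain ⟨u, hu⟩ := h t
    rw [← hu]
    exact u.2
  refine ⟨restrictPath V ((glueToX U V B).comp f) hV, ?_⟩
  ext t
  obtain ⟨u, hu⟩ := h t
  change f t = glueInr U V B ⟨glueToX U V B (f t), hV t⟩
  have : (⟨glueToX U V B (f t), hV t⟩ : V) = u :=
    Subtype.ext (congrArg (glueToX U V B) hu.symm)
  rw [this, hu]

theorem pathConnectedSpace_glue {B : Set X} (hU : IsPathConnected U) (hV : IsPathConnected V)
    {b : X} (hbU : b ∈ U) (hbV : b ∈ V) (hbB : b ∈ B) : PathConnectedSpace (Glue U V B) := by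
  have := isPathConnected_iff_pathConnectedSpace.1 hU
  have := isPathConnected_iff_pathConnectedSpace.1 hV
  have key : ∀ z : Glue U V B, Joined (glueInr U V B ⟨b, hbV⟩) z := by
    intro z
    rcases glue_cases z with ⟨u, rfl⟩ | ⟨v, rfl⟩
    · rw [glueInl_eq_glueInr hbU hbV hbB]
      exact ⟨(PathConnectedSpace.somePath ⟨b, hbU⟩ u).map (glueInl U V B).continuous⟩
    · exact ⟨(PathConnectedSpace.somePath ⟨b, hbV⟩ v).map (glueInr U V B).continuous⟩
  exact ⟨⟨glueInr U V B ⟨b, hbV⟩⟩, fun x y => (key x).symm.trans (key y)⟩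

end Glue

/-! ### Gluing two cocycles along the components of the intersection -/

section TwoSets

variable {X G : Type*} [TopologicalSpace X] [Group G] {U V : Set X}

/-- The inclusion of a subset. -/
abbrev valMap (W : Set X) : C(W, X) := ⟨Subtype.val, continuous_subtype_val⟩

/-- The inclusion in `U` of a path component of `U ∩ V`. -/
abbrev inclU (U V : Set X) (a : X) : C(comp U V a, U) := ContinuousMap.inclusion comp_subset_left

/-- The inclusion in `V` of a path component of `U ∩ V`. -/
abbrev inclV (U V : Set X) (a : X) : C(comp U V a, V) := ContinuousMap.inclusion comp_subset_right

theorem exists_glued_cocycle_pair (hUo : IsOpen U) (hVo : IsOpen V) (hUV : U ∪ V = univ)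
    (kU : PathCocycle U G) (kV : PathCocycle V G)
    (h : ∀ (f : C(I, X)) (hU : ∀ t, f t ∈ U) (hV : ∀ t, f t ∈ V),
      kU (restrictPath U f hU) = kV (restrictPath V f hV)) :
    ∃ c : PathCocycle X G, (∀ f : C(I, U), c ((valMap U).comp f) = kU f) ∧
      ∀ f : C(I, V), c ((valMap V).comp f) = kV f := by
  let W : Bool → Set X := fun i => if i then U else V
  let c : ∀ i, PathCocycle (W i) G := fun i => match i with
    | true => kU
    | false => kV
  obtain ⟨C, hC⟩ := exists_glued_cocycle (c := c) (by rintro (_ | _); exacts [hVo, hUo])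
    (fun x => by
      have hx : x ∈ U ∪ V := hUV ▸ mem_univ x
      rcases hx with hx | hx
      exacts [⟨true, hx⟩, ⟨false, hx⟩])
    (by
      rintro (_ | _) (_ | _) f hi hj
      · rfl
      · exact (h f hj hi).symm
      · exact h f hi hj
      · rfl)
  exact ⟨C, fun f => hC true f, fun f => hC false f⟩

theorem comp_eq_of_mem {a b x : X} (ha : x ∈ comp U V a) (hb : x ∈ comp U V b) :
    comp U V a = comp U V b := by
  exact (pathComponentIn_congr ha).symm.trans (pathComponentIn_congr hb)

variable {m : ℕ} {a : Fin (m + 1) → X} (ha : ∀ i, a i ∈ U ∩ V)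
    (p : ∀ k : Fin m, Path (⟨a 0, (ha 0).1⟩ : U) ⟨a k.succ, (ha k.succ).1⟩)
    (q : ∀ k : Fin m, Path (⟨a 0, (ha 0).2⟩ : V) ⟨a k.succ, (ha k.succ).2⟩)
    (kU : PathCocycle U G) (kV : PathCocycle V G) (τ : Fin m → G)

/-- The transition between the cocycles `kU` and `kV` at the end of a path `c` in the component
with index `k + 1`. -/
def transition (k : Fin m) {x : comp U V (a k.succ)} (c : Path ⟨a k.succ, mem_comp (ha k.succ)⟩ x) :
    G :=
  (kU (p k).toContinuousMap * kU ((inclU U V (a k.succ)).comp c.toContinuousMap))⁻¹ * τ k *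
    (kV (q k).toContinuousMap * kV ((inclV U V (a k.succ)).comp c.toContinuousMap))

/-- The relations that make it possible to glue `kU` and `kV`. -/
def Relations : Prop :=
  ∀ (k : Fin m) (r : Path (⟨a k.succ, mem_comp (ha k.succ)⟩ : comp U V (a k.succ))
      ⟨a k.succ, mem_comp (ha k.succ)⟩),
    kU (p k).toContinuousMap * kU ((inclU U V (a k.succ)).comp r.toContinuousMap) *
        (kU (p k).toContinuousMap)⁻¹ =
      τ k * (kV (q k).toContinuousMap * kV ((inclV U V (a k.succ)).comp r.toContinuousMap) *
        (kV (q k).toContinuousMap)⁻¹) * (τ k)⁻¹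

variable {ha p q kU kV τ}

theorem transition_eq (hrel : Relations ha p q kU kV τ) (k : Fin m) {x : comp U V (a k.succ)}
    (c c' : Path ⟨a k.succ, mem_comp (ha k.succ)⟩ x) :
    transition ha p q kU kV τ k c = transition ha p q kU kV τ k c' := by
  have h := hrel k (c.trans c'.symm)
  simp only [← PathCocycle.pull_apply, PathCocycle.map_trans, PathCocycle.map_symm] at h
  simp only [transition, ← PathCocycle.pull_apply]
  have e : ∀ {P C C' T Q D D' : G},
      P * (C * C'⁻¹) * P⁻¹ = T * (Q * (D * D'⁻¹) * Q⁻¹) * T⁻¹ →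
        (P * C)⁻¹ * T * (Q * D) = (P * C')⁻¹ * T * (Q * D') := by
    intro P C C' T Q D D' h
    have h' : P * (C * C'⁻¹) * P⁻¹ * T = T * (Q * (D * D'⁻¹) * Q⁻¹) := by rw [h]; group
    calc (P * C)⁻¹ * T * (Q * D) =
        (P * C)⁻¹ * (T * (Q * (D * D'⁻¹) * Q⁻¹)) * (Q * D') := by group
      _ = _ := by rw [← h']; group
  exact e h

theorem exists_transition (hA_inj : Function.Injective fun i => comp U V (a i))
    (hrel : Relations ha p q kU kV τ) :
    ∃ δ : U → G, (∀ x : U, (x : X) ∈ comp U V (a 0) → δ x = 1) ∧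
      ∀ (k : Fin m) (x : comp U V (a k.succ)) (c : Path ⟨a k.succ, mem_comp (ha k.succ)⟩ x),
        δ (inclU U V _ x) = transition ha p q kU kV τ k c := by
  have : ∀ x : U, ∃ d : G, ((x : X) ∈ comp U V (a 0) → d = 1) ∧
      ∀ (k : Fin m) (hx : (x : X) ∈ comp U V (a k.succ))
        (c : Path ⟨a k.succ, mem_comp (ha k.succ)⟩ (⟨x, hx⟩ : comp U V (a k.succ))),
        d = transition ha p q kU kV τ k c := by
    intro x
    by_cases hx : ∃ k : Fin m, (x : X) ∈ comp U V (a k.succ)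
    · obtain ⟨k, hx⟩ := hx
      have := isPathConnected_iff_pathConnectedSpace.1
        (isPathConnected_pathComponentIn (ha k.succ))
      refine ⟨transition ha p q kU kV τ k (PathConnectedSpace.somePath _ ⟨x, hx⟩), ?_, ?_⟩
      · intro h
        exact (Fin.succ_ne_zero k (hA_inj (comp_eq_of_mem hx h))).elim
      · intro k' hx' c
        obtain rfl : k = k' := Fin.succ_injective _ (hA_inj (comp_eq_of_mem hx hx'))
        exact transition_eq hrel k _ _
    · exact ⟨1, fun _ => rfl, fun k h => (hx ⟨k, h⟩).elim⟩
  choose δ h₂ h₃ using this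
  exact ⟨δ, h₂, fun k x c => h₃ (inclU U V _ x) k x.2 c⟩

/-- Two cocycles on open sets `U`, `V` that agree on one component of `U ∩ V` and satisfy suitable
relations on the others can be glued after a twist. -/
theorem exists_glued_twist (hUo : IsOpen U) (hVo : IsOpen V) (hUV : U ∪ V = univ)
    (hA_inj : Function.Injective fun i => comp U V (a i))
    (hA_cover : ⋃ i, comp U V (a i) = U ∩ V)
    (hB : ∀ f : C(I, comp U V (a 0)), kU ((inclU U V _).comp f) = kV ((inclV U V _).comp f))
    (hrel : Relations ha p q kU kV τ) :
    ∃ δ : U → G, (∀ x : U, (x : X) ∈ comp U V (a 0) → δ x = 1) ∧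
      (∀ (k : Fin m) (x : comp U V (a k.succ)) (c : Path ⟨a k.succ, mem_comp (ha k.succ)⟩ x),
        δ (inclU U V _ x) = transition ha p q kU kV τ k c) ∧
      ∃ c : PathCocycle X G, (∀ f : C(I, U), c ((valMap U).comp f) = kU.twist δ f) ∧
        ∀ f : C(I, V), c ((valMap V).comp f) = kV f := by
  obtain ⟨δ, h₂, h₃⟩ := exists_transition hA_inj hrel
  refine ⟨δ, h₂, h₃, exists_glued_cocycle_pair hUo hVo hUV _ _ fun f hU hV => ?_⟩
  have h0 : f 0 ∈ ⋃ i, comp U V (a i) := hA_cover ▸ ⟨hU 0, hV 0⟩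
  obtain ⟨i, hi⟩ := mem_iUnion.1 h0
  have hf : ∀ t, f t ∈ comp U V (a i) := fun t =>
    mem_comp_of_path f isPathConnected_univ (fun t _ => ⟨hU t, hV t⟩) (mem_univ 0) hi (mem_univ t)
  induction i using Fin.cases with
  | zero =>
    rw [PathCocycle.twist_apply, h₂ _ (hf 0), h₂ _ (hf 1), inv_one, one_mul, mul_one]
    exact hB (restrictPath _ f hf)
  | succ k =>
    have := isPathConnected_iff_pathConnectedSpace.1
      (isPathConnected_pathComponentIn (ha k.succ))
    let g : C(I, comp U V (a k.succ)) := restrictPath _ f hf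
    let c : Path ⟨a k.succ, mem_comp (ha k.succ)⟩ (g 0) := PathConnectedSpace.somePath _ _
    have e₀ := h₃ k (g 0) c
    have e₁ := h₃ k (g 1) (c.trans (toPath g))
    rw [PathCocycle.twist_apply]
    change (δ (inclU U V _ (g 0)))⁻¹ * kU ((inclU U V _).comp (toPath g).toContinuousMap) *
      δ (inclU U V _ (g 1)) = kV ((inclV U V _).comp (toPath g).toContinuousMap)
    rw [e₀, e₁]
    simp only [transition, ← PathCocycle.pull_apply, PathCocycle.map_trans]
    group

end TwoSets

/-! ### Cocycles on the glued space and the homomorphisms of the presentation -/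

section Presentation

variable {X G : Type*} [TopologicalSpace X] [Group G] {U V B : Set X}

theorem hom_changeBase (c : PathCocycle X G) {b a : X} (p : Path b a) (r : Path a a) :
    c.hom b (changeBase p (loopClass r)) =
      c p.toContinuousMap * c r.toContinuousMap * (c p.toContinuousMap)⁻¹ := by
  rw [changeBase_loopClass, c.hom_loopClass, c.map_trans, c.map_trans, c.map_symm, mul_assoc]

theorem hom_thetaHat (c : PathCocycle (Glue U V B) G) {A : Set X} {b a : X} (hU : b ∈ U)
    (hV : b ∈ V) (hB : b ∈ B) (hAU : A ⊆ U) (ha : a ∈ A) (p : Path (⟨b, hU⟩ : U) ⟨a, hAU ha⟩)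
    (r : Path (⟨a, ha⟩ : A) ⟨a, ha⟩) :
    c.hom _ (thetaHat U V B hU hV hB hAU ha p (loopClass r)) =
      c ((glueInl U V B).comp p.toContinuousMap) *
        c ((glueInl U V B).comp ((ContinuousMap.inclusion hAU).comp r.toContinuousMap)) *
        (c ((glueInl U V B).comp p.toContinuousMap))⁻¹ := by
  exact hom_changeBase c ((p.map (glueInl U V B).continuous).cast (glueInl_eq_glueInr hU hV hB) rfl)
    (r.map ((glueInl U V B).comp (ContinuousMap.inclusion hAU)).continuous)

theorem hom_theta (c : PathCocycle (Glue U V B) G) {A : Set X} {b a : X}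
    (hV : b ∈ V) (hAV : A ⊆ V) (ha : a ∈ A) (q : Path (⟨b, hV⟩ : V) ⟨a, hAV ha⟩)
    (r : Path (⟨a, ha⟩ : A) ⟨a, ha⟩) :
    c.hom _ (theta U V B hV hAV ha q (loopClass r)) =
      c ((glueInr U V B).comp q.toContinuousMap) *
        c ((glueInr U V B).comp ((ContinuousMap.inclusion hAV).comp r.toContinuousMap)) *
        (c ((glueInr U V B).comp q.toContinuousMap))⁻¹ := by
  exact hom_changeBase c (q.map (glueInr U V B).continuous)
    (r.map ((glueInr U V B).comp (ContinuousMap.inclusion hAV)).continuous)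

theorem HNNQuotient.proj_relation {ι G : Type*} [Group G] {H : ι → Type*} [∀ k, Group (H k)]
    (φ ψ : ∀ k, H k →* G) (k : ι) (α : H k) :
    HNNQuotient.proj (φ := φ) (ψ := ψ) (Monoid.Coprod.inl (φ k α)) =
      HNNQuotient.proj (Monoid.Coprod.inr (FreeGroup.of k)) *
        HNNQuotient.proj (Monoid.Coprod.inl (ψ k α)) *
        (HNNQuotient.proj (Monoid.Coprod.inr (FreeGroup.of k)))⁻¹ := by
  rw [← mul_inv_eq_one, ← map_inv, ← map_mul, ← map_mul, ← map_inv, ← map_mul]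
  exact (QuotientGroup.eq_one_iff _).2 (Subgroup.subset_normalClosure ⟨k, α, rfl⟩)

theorem HNNQuotient.relators_le_ker {ι G K : Type*} [Group G] [Group K] {H : ι → Type*}
    [∀ k, Group (H k)] (φ ψ : ∀ k, H k →* G) (f : G →* K) (t : ι → K)
    (h : ∀ k α, f (φ k α) = t k * f (ψ k α) * (t k)⁻¹) :
    Subgroup.normalClosure (hnnRelators φ ψ) ≤
      (Monoid.Coprod.lift f (FreeGroup.lift t)).ker := by
  refine Subgroup.normalClosure_le_normal ?_
  rintro _ ⟨k, α, rfl⟩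
  simp [MonoidHom.mem_ker, h]

end Presentation

/-! ### Homomorphisms from the fundamental group of the union -/

section Union

variable {X G : Type*} [TopologicalSpace X] [Group G] {U V : Set X}

theorem pathConnectedSpace_of_union (hU : IsPathConnected U) (hV : IsPathConnected V)
    (hUV : U ∪ V = univ) {b : X} (hb : b ∈ U ∩ V) : PathConnectedSpace X := by
  rw [pathConnectedSpace_iff_univ, ← hUV]
  exact hU.union hV ⟨b, hb⟩

/-- The function on the glued space that is `δ` on `U` and `1` on `V`. -/
def glueLift {B : Set X} (δ : U → G) (hδ : ∀ x : U, (x : X) ∈ B → δ x = 1) : Glue U V B → G :=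
  Quotient.lift (Sum.elim δ fun _ => 1) (by
    rintro (u | v) (u' | v') (h | ⟨h, hB⟩)
    · rw [h]
    · rw [Subtype.ext h]
    · cases h
    · exact hδ u hB
    · cases h
    · exact (hδ u' (by rw [h] at hB; exact hB)).symm
    · rfl
    · rfl)

/-- A cocycle on `X` that comes from a cocycle `k` on the glued space by a twist on `U` pulls back
to a twist of `k`. -/
theorem pull_glueToX_eq_twist (hUo : IsOpen U) (hVo : IsOpen V) {a₀ : X}
    (hA₀ : IsOpen (comp U V a₀) ∨ T2Space X) (k : PathCocycle (Glue U V (comp U V a₀)) G)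
    (c : PathCocycle X G) (δ : U → G) (hδ : ∀ x : U, (x : X) ∈ comp U V a₀ → δ x = 1)
    (hcU : ∀ f : C(I, U), c ((valMap U).comp f) = (k.pull (glueInl U V _)).twist δ f)
    (hcV : ∀ f : C(I, V), c ((valMap V).comp f) = k.pull (glueInr U V _) f)
    (f : C(I, Glue U V (comp U V a₀))) :
    c ((glueToX U V _).comp f) = k.twist (glueLift δ hδ) f := by
  obtain ⟨o₁, o₂⟩ := isOpen_preimage_range hUo hVo hA₀ f
  refine PathCocycle.eq_of_open_cover (c.pull (glueToX U V _)) _ _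
    (fun i : Bool => if i then f ⁻¹' range (glueInl U V _) else f ⁻¹' range (glueInr U V _))
    ?_ ?_ ?_
  · rintro (_ | _)
    exacts [o₂, o₁]
  · intro x
    rcases glue_cases (f x) with h | h
    exacts [⟨true, h⟩, ⟨false, h⟩]
  · rintro (_ | _) g hg
    · obtain ⟨f', hf⟩ := exists_eq_glueInr_comp (f := f.comp g) hg
      rw [hf]
      refine (hcV f').trans ?_
      rw [PathCocycle.twist_apply]
      change _ = (1 : G)⁻¹ * k ((glueInr U V _).comp f') * 1
      rw [inv_one, one_mul, mul_one]
      rfl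
    · obtain ⟨f', hf⟩ := exists_eq_glueInl_comp (f := f.comp g) hg
      rw [hf]
      exact hcU f'

variable {m : ℕ} {a : Fin (m + 1) → X} (ha : ∀ i, a i ∈ U ∩ V)
    (p : ∀ k : Fin m, Path (⟨a 0, (ha 0).1⟩ : U) ⟨a k.succ, (ha k.succ).1⟩)
    (q : ∀ k : Fin m, Path (⟨a 0, (ha 0).2⟩ : V) ⟨a k.succ, (ha k.succ).2⟩)

/-- The class of the loop `p k · (q k)⁻¹`. -/
def crossing (k : Fin m) : PiOne X (a 0) :=
  loopClass (((p k).map continuous_subtype_val).trans ((q k).map continuous_subtype_val).symm)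

theorem hom_crossing (c : PathCocycle X G) (k : Fin m) :
    c.hom (a 0) (crossing ha p q k) = c ((valMap U).comp (p k).toContinuousMap) *
      (c ((valMap V).comp (q k).toContinuousMap))⁻¹ := by
  rw [crossing, c.hom_loopClass, c.map_trans, c.map_symm]
  rfl

theorem hom_sigmaStar {B : Set X} {b : X} (hb : b ∈ V) (c : PathCocycle X G) :
    (c.hom b).comp (sigmaStar U V B hb) =
      (c.pull (glueToX U V B)).hom (glueInr U V B ⟨b, hb⟩) := by
  refine monoidHom_ext_loopClass fun γ => ?_
  rw [PathCocycle.hom_loopClass]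
  exact c.hom_loopClass (b := b) (γ.map (glueToX U V B).continuous)

/-- The relations between the images of the fundamental group of the glued space and the classes
`crossing`. -/
theorem sigmaStar_thetaHat [PathConnectedSpace X] (k : Fin m)
    (α : PiOne (comp U V (a k.succ)) ⟨a k.succ, mem_comp (ha k.succ)⟩) :
    sigmaStar U V (comp U V (a 0)) (ha 0).2 (thetaHat U V (comp U V (a 0)) (ha 0).1 (ha 0).2
        (mem_comp (ha 0)) comp_subset_left (mem_comp (ha k.succ)) (p k) α) =
      crossing ha p q k * sigmaStar U V (comp U V (a 0)) (ha 0).2 (theta U V (comp U V (a 0))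
        (ha 0).2 comp_subset_right (mem_comp (ha k.succ)) (q k) α) *
        (crossing ha p q k)⁻¹ := by
  obtain ⟨κ, hκ⟩ := exists_cocycle_loopClass (a 0)
  have hid : κ.hom (a 0) = MonoidHom.id _ := monoidHom_ext_loopClass fun γ => by
    rw [κ.hom_loopClass, hκ]
    rfl
  obtain ⟨r, rfl⟩ := loopClass_surjective _ α
  have h : ∀ x, sigmaStar U V (comp U V (a 0)) (ha 0).2 x =
      (κ.pull (glueToX U V _)).hom (glueInr U V _ ⟨a 0, (ha 0).2⟩) x := fun x => by
    rw [← hom_sigmaStar, hid]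
    rfl
  have h' := hom_crossing ha p q κ k
  rw [hid, MonoidHom.id_apply] at h'
  rw [h, h, hom_thetaHat, hom_theta, h']
  change κ ((valMap U).comp (p k).toContinuousMap) *
      κ ((valMap (comp U V (a k.succ))).comp r.toContinuousMap) *
      (κ ((valMap U).comp (p k).toContinuousMap))⁻¹ = _ *
    (κ ((valMap V).comp (q k).toContinuousMap) *
      κ ((valMap (comp U V (a k.succ))).comp r.toContinuousMap) *
      (κ ((valMap V).comp (q k).toContinuousMap))⁻¹) * _
  group

/-- A homomorphism from the fundamental group of the glued space and elements `τ k` that satisfy the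
relations define a homomorphism from the fundamental group of `X`. -/
theorem exists_hom_of_relations (hUo : IsOpen U) (hVo : IsOpen V) (hU : IsPathConnected U)
    (hV : IsPathConnected V) (hUV : U ∪ V = univ)
    (hA_inj : Function.Injective fun i => comp U V (a i))
    (hA_cover : ⋃ i, comp U V (a i) = U ∩ V)
    (hA₀ : IsOpen (comp U V (a 0)) ∨ T2Space X)
    (π : PiOne (Glue U V (comp U V (a 0))) (glueInr U V (comp U V (a 0)) ⟨a 0, (ha 0).2⟩) →* G)
    (τ : Fin m → G)
    (hrel : ∀ (k : Fin m) α, π (thetaHat U V (comp U V (a 0)) (ha 0).1 (ha 0).2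
        (mem_comp (ha 0)) comp_subset_left (mem_comp (ha k.succ)) (p k) α) =
      τ k * π (theta U V (comp U V (a 0)) (ha 0).2 comp_subset_right (mem_comp (ha k.succ))
        (q k) α) * (τ k)⁻¹) :
    ∃ Ψ : PiOne X (a 0) →* G, (∀ γ, Ψ (sigmaStar U V (comp U V (a 0)) (ha 0).2 γ) = π γ) ∧
      ∀ k, Ψ (crossing ha p q k) = τ k := by
  have hb : a 0 ∈ comp U V (a 0) := mem_comp (ha 0)
  have := pathConnectedSpace_glue hU hV (ha 0).1 (ha 0).2 hb
  obtain ⟨κ, hκ⟩ := exists_cocycle_loopClass (glueInr U V (comp U V (a 0)) ⟨a 0, (ha 0).2⟩)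
  have hπ : (κ.push π).hom _ = π := monoidHom_ext_loopClass fun γ => by
    rw [PathCocycle.hom_loopClass, PathCocycle.push_apply, hκ]
  have hrel' : Relations ha p q ((κ.push π).pull (glueInl U V _))
      ((κ.push π).pull (glueInr U V _)) τ := by
    intro k r
    have h := hrel k (loopClass r)
    rw [← hπ, hom_thetaHat, hom_theta] at h
    exact h
  obtain ⟨δ, hδ, hδ', c, hcU, hcV⟩ := exists_glued_twist hUo hVo hUV hA_inj hA_cover
    (fun f => congrArg (κ.push π).toFun (ContinuousMap.ext fun s =>
      (glueInl_eq_glueInr (comp_subset_left (f s).2) (comp_subset_right (f s).2) (f s).2).symm))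
    hrel'
  refine ⟨c.hom (a 0), fun γ => ?_, fun k => ?_⟩
  · obtain ⟨γ, rfl⟩ := loopClass_surjective _ γ
    rw [← MonoidHom.comp_apply, hom_sigmaStar, PathCocycle.hom_loopClass, PathCocycle.pull_apply,
      pull_glueToX_eq_twist hUo hVo hA₀ (κ.push π) c δ hδ hcU hcV, PathCocycle.twist_path,
      PathCocycle.push_apply, hκ]
    change (1 : G)⁻¹ * _ * 1 = _
    rw [inv_one, one_mul, mul_one]
  · have e := hδ' k ⟨a k.succ, mem_comp (ha k.succ)⟩ (Path.refl _)
    have r₁ := fun x : comp U V (a k.succ) =>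
      (((κ.push π).pull (glueInl U V _)).pull (inclU U V (a k.succ))).map_refl x
    have r₂ := fun x : comp U V (a k.succ) =>
      (((κ.push π).pull (glueInr U V _)).pull (inclV U V (a k.succ))).map_refl x
    simp only [PathCocycle.pull_apply _ (inclU U V (a k.succ)),
      PathCocycle.pull_apply _ (inclV U V (a k.succ))] at r₁ r₂
    rw [transition, r₁, r₂, mul_one, mul_one] at e
    rw [hom_crossing, hcU, hcV, PathCocycle.twist_path, hδ _ hb]
    refine (congrArg (fun x => 1⁻¹ * _ * x * _) e).trans ?_
    group

/-- The fundamental group of `X` is generated by the image of the fundamental group of the glued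
space together with the classes `crossing`. -/
theorem hom_ext_of_sigmaStar_of_crossing (hUo : IsOpen U) (hVo : IsOpen V)
    (hU : IsPathConnected U) (hV : IsPathConnected V) (hUV : U ∪ V = univ)
    (hA_cover : ⋃ i, comp U V (a i) = U ∩ V) (φ ψ : PiOne X (a 0) →* G)
    (hσ : ∀ γ, φ (sigmaStar U V (comp U V (a 0)) (ha 0).2 γ) =
      ψ (sigmaStar U V (comp U V (a 0)) (ha 0).2 γ))
    (ht : ∀ k, φ (crossing ha p q k) = ψ (crossing ha p q k)) : φ = ψ := by
  classical
  have hb : a 0 ∈ comp U V (a 0) := mem_comp (ha 0)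
  have := pathConnectedSpace_glue hU hV (ha 0).1 (ha 0).2 hb
  have := pathConnectedSpace_of_union hU hV hUV (ha 0)
  obtain ⟨κ, hκ⟩ := exists_cocycle_loopClass (a 0)
  have hφ : ∀ φ : PiOne X (a 0) →* G, (κ.push φ).hom (a 0) = φ := fun φ =>
    monoidHom_ext_loopClass fun γ => by
      rw [PathCocycle.hom_loopClass, PathCocycle.push_apply, hκ]
  obtain ⟨c, hc⟩ : ∃ c, c = κ.push φ := ⟨_, rfl⟩
  obtain ⟨d, hd⟩ : ∃ d, d = κ.push ψ := ⟨_, rfl⟩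
  have hcφ : c.hom (a 0) = φ := by rw [hc, hφ]
  have hdψ : d.hom (a 0) = ψ := by rw [hd, hφ]
  obtain ⟨e, he, hee⟩ := exists_eq_twist (glueInr U V (comp U V (a 0)) ⟨a 0, (ha 0).2⟩)
    (c.pull (glueToX U V _)) (d.pull (glueToX U V _)) (fun γ => by
      rw [← PathCocycle.hom_loopClass, ← PathCocycle.hom_loopClass, ← hom_sigmaStar,
        ← hom_sigmaStar, MonoidHom.comp_apply, MonoidHom.comp_apply, hcφ, hdψ]
      exact hσ _)
  have he' : e (glueInl U V (comp U V (a 0)) ⟨a 0, (ha 0).1⟩) = 1 := by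
    rw [← glueInl_eq_glueInr (ha 0).1 (ha 0).2 hb]
    exact he
  have hcU : ∀ {x y : U} (γ : Path x y), c ((valMap U).comp γ.toContinuousMap) =
      (e (glueInl U V _ x))⁻¹ * d ((valMap U).comp γ.toContinuousMap) * e (glueInl U V _ y) :=
    fun γ => hee (γ.map (glueInl U V _).continuous)
  have hcV : ∀ {x y : V} (γ : Path x y), c ((valMap V).comp γ.toContinuousMap) =
      (e (glueInr U V _ x))⁻¹ * d ((valMap V).comp γ.toContinuousMap) * e (glueInr U V _ y) :=
    fun γ => hee (γ.map (glueInr U V _).continuous)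
  have agree : ∀ (x : X) (hxU : x ∈ U) (hxV : x ∈ V),
      e (glueInl U V _ ⟨x, hxU⟩) = e (glueInr U V _ ⟨x, hxV⟩) := by
    intro x hxU hxV
    have hx' : x ∈ ⋃ i, comp U V (a i) := hA_cover ▸ ⟨hxU, hxV⟩
    obtain ⟨i, hi⟩ := mem_iUnion.1 hx'
    induction i using Fin.cases with
    | zero => exact congrArg e (glueInl_eq_glueInr hxU hxV hi).symm
    | succ k =>
      have := isPathConnected_iff_pathConnectedSpace.1
        (isPathConnected_pathComponentIn (ha k.succ))
      let r : Path (⟨a k.succ, mem_comp (ha k.succ)⟩ : comp U V (a k.succ)) ⟨x, hi⟩ :=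
        PathConnectedSpace.somePath _ _
      have h₁ := hcU (p k)
      have h₂ := hcV (q k)
      have h₃ : c ((valMap _).comp r.toContinuousMap) =
          (e (glueInl U V _ ⟨a k.succ, (ha k.succ).1⟩))⁻¹ *
            d ((valMap _).comp r.toContinuousMap) * e (glueInl U V _ ⟨x, hxU⟩) :=
        hcU (r.map (inclU U V _).continuous)
      have h₄ : c ((valMap _).comp r.toContinuousMap) =
          (e (glueInr U V _ ⟨a k.succ, (ha k.succ).2⟩))⁻¹ *
            d ((valMap _).comp r.toContinuousMap) * e (glueInr U V _ ⟨x, hxV⟩) :=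
        hcV (r.map (inclV U V _).continuous)
      have h₅ := ht k
      rw [← hcφ, ← hdψ, hom_crossing, hom_crossing, h₁, h₂, he, he'] at h₅
      have h₆ : e (glueInl U V _ ⟨a k.succ, (ha k.succ).1⟩) =
          e (glueInr U V _ ⟨a k.succ, (ha k.succ).2⟩) := by
        rw [inv_one, one_mul, one_mul, mul_inv_rev, mul_assoc, mul_right_inj, ← mul_assoc,
          mul_eq_right, mul_inv_eq_one] at h₅
        exact h₅
      rw [h₃, h₆] at h₄
      exact mul_left_cancel h₄
  let ε : X → G := fun x =>
    if hx : x ∈ V then e (glueInr U V _ ⟨x, hx⟩) else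
      if hx : x ∈ U then e (glueInl U V _ ⟨x, hx⟩) else 1
  have hεV : ∀ x : V, ε x = e (glueInr U V _ x) := fun x => dif_pos x.2
  have hεU : ∀ x : U, ε x = e (glueInl U V _ x) := by
    intro x
    by_cases hx : (x : X) ∈ V
    · exact (hεV ⟨x, hx⟩).trans (agree x x.2 hx).symm
    · exact (dif_neg hx).trans (dif_pos x.2)
  rw [← hcφ, ← hdψ]
  refine monoidHom_ext_loopClass fun γ => ?_
  have key : c γ.toContinuousMap = d.twist ε γ.toContinuousMap := by
    refine PathCocycle.eq_of_open_cover _ _ _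
      (fun i : Bool => if i then γ.toContinuousMap ⁻¹' U else γ.toContinuousMap ⁻¹' V) ?_ ?_ ?_
    · rintro (_ | _)
      exacts [hVo.preimage γ.continuous, hUo.preimage γ.continuous]
    · intro x
      have hx : γ x ∈ U ∪ V := hUV ▸ mem_univ _
      rcases hx with h | h
      exacts [⟨true, h⟩, ⟨false, h⟩]
    · rintro (_ | _) g hg
      · have h := hcV (toPath (restrictPath V (γ.toContinuousMap.comp g) hg))
        rw [← hεV, ← hεV] at h
        exact h
      · have h := hcU (toPath (restrictPath U (γ.toContinuousMap.comp g) hg))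
        rw [← hεU, ← hεU] at h
        exact h
  have hε : ε (a 0) = 1 := (hεV ⟨a 0, (ha 0).2⟩).trans he
  rw [PathCocycle.hom_loopClass, PathCocycle.hom_loopClass, key, PathCocycle.twist_path, hε,
    inv_one, one_mul, mul_one]

end Union

end VanKampen

end

theorem mainTheorem3 {X : Type*} [TopologicalSpace X] {U V : Set X}
    (hUo : IsOpen U) (hVo : IsOpen V)
    (hU : IsPathConnected U) (hV : IsPathConnected V) (hUV : U ∪ V = Set.univ)
    -- the path components `A i = comp U V (a i)`, `i = 0, …, m`, of `U ∩ V`, each listed once,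
    -- with a point `a i` in each; the base point is `b = a 0`
    {m : ℕ} (a : Fin (m + 1) → X) (ha : ∀ i, a i ∈ U ∩ V)
    (hA_inj : Function.Injective fun i => VanKampen.comp U V (a i))
    (hA_cover : ⋃ i, VanKampen.comp U V (a i) = U ∩ V)
    (hA₀ : IsOpen (VanKampen.comp U V (a 0)) ∨ T2Space X)
    -- paths `p k` in `U` and `q k` in `V` from `b` to the points `a 1, …, a m`
    (p : ∀ k : Fin m, Path (⟨a 0, (ha 0).1⟩ : U) ⟨a k.succ, (ha k.succ).1⟩)
    (q : ∀ k : Fin m, Path (⟨a 0, (ha 0).2⟩ : V) ⟨a k.succ, (ha k.succ).2⟩) :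
    ∃ Φ : VanKampen.HNNQuotient
        (fun k : Fin m => VanKampen.thetaHat U V (VanKampen.comp U V (a 0))
          (ha 0).1 (ha 0).2 (VanKampen.mem_comp (ha 0))
          VanKampen.comp_subset_left (VanKampen.mem_comp (ha k.succ)) (p k))
        (fun k : Fin m => VanKampen.theta U V (VanKampen.comp U V (a 0))
          (ha 0).2
          VanKampen.comp_subset_right (VanKampen.mem_comp (ha k.succ)) (q k))
        ≃* VanKampen.PiOne X (a 0),
      (∀ γ, Φ (VanKampen.HNNQuotient.proj (Monoid.Coprod.inl γ)) =
        VanKampen.sigmaStar U V (VanKampen.comp U V (a 0)) (ha 0).2 γ) ∧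
      ∀ k : Fin m,
        Φ (VanKampen.HNNQuotient.proj (Monoid.Coprod.inr (FreeGroup.of k))) =
          VanKampen.loopClass
            (((p k).map continuous_subtype_val).trans
              ((q k).map continuous_subtype_val).symm) := by
  have := VanKampen.pathConnectedSpace_of_union hU hV hUV (ha 0)
  have hker := VanKampen.HNNQuotient.relators_le_ker _ _
    (VanKampen.sigmaStar U V (VanKampen.comp U V (a 0)) (ha 0).2) (VanKampen.crossing ha p q)
    (VanKampen.sigmaStar_thetaHat ha p q)
  obtain ⟨Ψ, hΨl, hΨr⟩ := VanKampen.exists_hom_of_relations ha p q hUo hVo hU hV hUV hA_inj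
    hA_cover hA₀ (VanKampen.HNNQuotient.proj.comp Monoid.Coprod.inl)
    (fun k => VanKampen.HNNQuotient.proj (Monoid.Coprod.inr (FreeGroup.of k)))
    (VanKampen.HNNQuotient.proj_relation _ _)
  have hΦl : ∀ γ, QuotientGroup.lift _ _ hker (VanKampen.HNNQuotient.proj
      (Monoid.Coprod.inl γ)) = VanKampen.sigmaStar U V (VanKampen.comp U V (a 0)) (ha 0).2 γ :=
    fun γ => (QuotientGroup.lift_mk' _ hker _).trans (Monoid.Coprod.lift_apply_inl _ _ _)
  have hΦr : ∀ k, QuotientGroup.lift _ _ hker (VanKampen.HNNQuotient.proj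
      (Monoid.Coprod.inr (FreeGroup.of k))) = VanKampen.crossing ha p q k :=
    fun k => (QuotientGroup.lift_mk' _ hker _).trans
      ((Monoid.Coprod.lift_apply_inr _ _ _).trans FreeGroup.lift_apply_of)
  refine ⟨MonoidHom.toMulEquiv (QuotientGroup.lift _ _ hker) Ψ ?_ ?_, hΦl, hΦr⟩
  · refine QuotientGroup.monoidHom_ext _ (Monoid.Coprod.hom_ext ?_ ?_)
    · exact MonoidHom.ext fun γ => (congrArg Ψ (hΦl γ)).trans (hΨl γ)
    · exact FreeGroup.ext_hom _ _ fun k => (congrArg Ψ (hΦr k)).trans (hΨr k)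
  · refine VanKampen.hom_ext_of_sigmaStar_of_crossing ha p q hUo hVo hU hV hUV hA_cover _ _
      (fun γ => ?_) (fun k => ?_)
    · exact (congrArg _ (hΨl γ)).trans (hΦl γ)
    · exact (congrArg _ (hΨr k)).trans (hΦr k)
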